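/- Let $\Omega\subset\mathbb R^n$ be a bounded domain, $1<p<\infty$, $\sigma>1$, and write $s'=s/(s-1)$ for the conjugate exponent of $s>1$. Let $v\ge 0$ be a weight on $\Omega$ with $v\in L^1(\Omega)$, and let $Q$ be a measurable function on $\Omega$ whose values are symmetric nonnegative definite $n\times n$ matrices, such that for some constant $k$, $|Q(x)|_{\mathrm{op}}^{p/2}\le k\,v(x)$ for a.e. $x\in\Omega$. Let $\mathrm{Lip}_0(\Omega)$ be the locally Lipschitz functions on $\Omega$ with compact support in $\Omega$, and put $\|\mathbf h\|_{QL^p(\Omega)}=\left(\int_\Omega|\sqrt{Q}\,\mathbf h|^p\,dx\right)^{1/p}$. For a function $A:[0,\infty)\to[0,\infty)$ put $$\|h\|_{L^A(v,\Omega)}=\inf\Big\{\lambda>0:\int_\Omega A(|h|/\lambda)\,v\,dx\le 1\Big\},$$ and let $L^A(v,\Omega)$ be the set of measurable $h$ for which this is finite. Suppose that for $N(t)=t^{\sigma p}$ the Sobolev inequality $\|\varphi\|_{L^N(v,\Omega)}\le S_N\|\nabla\varphi\|_{QL^p(\Omega)}$ holds for all $\varphi\in\mathrm{Lip}_0(\Omega)$,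 and let $\mathbf t:\Omega\to\mathbb R^n$ be measurable and define a degenerate subunit vector field with constant $C(\mathbf t)$, that is, $$\|\mathbf t\cdot\nabla\varphi\|_{L^p(v,\Omega)}\le C(\mathbf t)\,\|\nabla\varphi\|_{QL^p(\Omega)}\quad\text{for all }\varphi\in\mathrm{Lip}_0(\Omega).$$ Let $QH^{1,p}_0(v,\Omega)$ be the set of pairs $(u,\nabla u)\in L^p(v,\Omega)\times QL^p(\Omega)$ that are limits in $L^p(v,\Omega)\times QL^p(\Omega)$ of pairs $(\psi_j,\nabla\psi_j)$ with $\psi_j\in\mathrm{Lip}_0(\Omega)$ (here $\nabla u$ denotes the second component of the pair). Such a pair is a degenerate weak solution of the Dirichlet problem $$-v^{-1}\operatorname{div}\big(|\sqrt Q\nabla u|^{p-2}Q\nabla u\big)=f|f|^{p-2}-v^{-1}\operatorname{div}\big(v|g|^{p-2}g\,\mathbf t\big)\ \text{in }\Omega,\qquad u=0\ \text{on }\partial\Omega,$$ if $$\int_\Omega|\sqrt Q\nabla u|^{p-2}\,\nabla\varphi\cdot Q\nabla u\,dx=\int_\Omega\big(f|f|^{p-2}\varphi+|g|^{p-2}g\,\mathbf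 t\cdot\nabla\varphi\big)\,v\,dx$$ for every $\varphi\in\mathrm{Lip}_0(\Omega)$; it is a degenerate weak subsolution (supersolution) if this holds with $=$ replaced by $\le$ ($\ge$) for every nonnegative $\varphi\in\mathrm{Lip}_0(\Omega)$. Let $q>\sigma'(p-1)$, $A(t)=t^{\sigma'(p-1)}\log(e+t)^q$ and $B(t)=t^{p\sigma'}\log(e+t)^{qp'}$. Then there is a constant $C$, depending only on $n,p,\sigma,q,S_N,\mathbf t,C(\mathbf t),\Omega$ and $v$, such that for all $f\in L^A(v,\Omega)$ and $g\in L^B(v,\Omega)$: every degenerate weak subsolution (supersolution) $(u,\nabla u)\in QH^{1,p}_0(v,\Omega)$ satisfies $u^+\in L^\infty(v,\Omega)$ ($u^-\in L^\infty(v,\Omega)$) and $$\|u^{+}\|_{L^\infty(v,\Omega)}\ \big(\|u^-\|_{L^\infty(v,\Omega)}\big)\ \le\ C\big(\|f\|_{L^A(v,\Omega)}+\|g\|_{L^B(v,\Omega)}\big),$$ where $u^+=\max(u,0)$, $u^-=\max(-u,0)$. If $u$ is a degenerate weak solution, then $u\in L^\infty(v,\Omega)$ and $\|u\|_{L^\infty(v,\Omega)}\le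 C(\|f\|_{L^A(v,\Omega)}+\|g\|_{L^B(v,\Omega)})$. -/

import Mathlib

open MeasureTheory Filter Topology Set
open scoped NNReal ENNReal MatrixOrder

noncomputable section

/-- The measure `v dx` on `Ω`. -/
def weightMeasure {n : ℕ} (v : EuclideanSpace ℝ (Fin n) → ℝ)
    (Ω : Set (EuclideanSpace ℝ (Fin n))) : Measure (EuclideanSpace ℝ (Fin n)) :=
  (volume.restrict Ω).withDensity (fun x => ENNReal.ofReal (v x))

/-- The Luxemburg norm
`‖h‖_{L^A(μ)} = inf {lam > 0 : ∫ A(|h| / lam) dμ ≤ 1}`, with value `∞` if there is no such `lam`. -/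
def luxemburgNorm {X : Type*} [MeasurableSpace X] (A : ℝ → ℝ) (μ : Measure X) (h : X → ℝ) :
    ℝ≥0∞ :=
  ⨅ (lam : ℝ) (_ : 0 < lam) (_ : ∫⁻ x, ENNReal.ofReal (A (|h x| / lam)) ∂μ ≤ 1),
    ENNReal.ofReal lam

/-- `h ∈ L^A(μ)`. -/
def MemOrlicz {X : Type*} [MeasurableSpace X] (A : ℝ → ℝ) (μ : Measure X) (h : X → ℝ) : Prop :=
  AEMeasurable h μ ∧ luxemburgNorm A μ h < ∞

/-- The power function `t ^ r`. -/
def powerFun (r t : ℝ) : ℝ := t ^ r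

/-- The log bump `t ^ r * log (e + t) ^ q`. -/
def logBump (r q t : ℝ) : ℝ := t ^ r * Real.log (Real.exp 1 + t) ^ q

/-- `φ ∈ Lip₀(Ω)`: locally Lipschitz on `Ω` with compact support in `Ω`; here `φ` is extended
by zero to the whole space. -/
def IsLipZero {n : ℕ} (Ω : Set (EuclideanSpace ℝ (Fin n)))
    (φ : EuclideanSpace ℝ (Fin n) → ℝ) : Prop :=
  LocallyLipschitzOn Ω φ ∧ HasCompactSupport φ ∧ tsupport φ ⊆ Ω

/-- `|√M ξ|`, the Euclidean norm of the image of `ξ` under the nonnegative definite square root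
of the nonnegative definite matrix `M`. -/
def sqrtMulNorm {n : ℕ} (M : Matrix (Fin n) (Fin n) ℝ) (ξ : EuclideanSpace ℝ (Fin n)) : ℝ :=
  ‖Matrix.toEuclideanCLM (𝕜 := ℝ) (CFC.sqrt M) ξ‖

/-- `|√M ξ|² = ξ · M ξ`. -/
theorem sqrtMulNorm_sq {n : ℕ} {M : Matrix (Fin n) (Fin n) ℝ} (hM : M.PosSemidef)
    (ξ : EuclideanSpace ℝ (Fin n)) :
    sqrtMulNorm M ξ ^ 2 = inner ℝ ξ (Matrix.toEuclideanCLM (𝕜 := ℝ) M ξ) := by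
  have hs : star (CFC.sqrt M) = CFC.sqrt M :=
    (IsSelfAdjoint.of_nonneg (CFC.sqrt_nonneg M)).star_eq
  have h2 : CFC.sqrt M * CFC.sqrt M = M := CFC.sqrt_mul_sqrt_self M hM.nonneg
  unfold sqrtMulNorm
  conv_rhs => rw [← h2, map_mul]
  rw [← real_inner_self_eq_norm_sq, mul_apply_eq_comp]
  conv_rhs => rw [← ContinuousLinearMap.adjoint_inner_left, ← ContinuousLinearMap.star_eq_adjoint,
    ← map_star, hs]

/-- The seminorm `‖G‖_{QL^p(Ω)} = (∫_Ω |√Q G|^p dx)^{1/p}`. -/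
def matrixNorm {n : ℕ} (Q : EuclideanSpace ℝ (Fin n) → Matrix (Fin n) (Fin n) ℝ) (p : ℝ)
    (Ω : Set (EuclideanSpace ℝ (Fin n)))
    (G : EuclideanSpace ℝ (Fin n) → EuclideanSpace ℝ (Fin n)) : ℝ≥0∞ :=
  eLpNorm (fun x => sqrtMulNorm (Q x) (G x)) (ENNReal.ofReal p) (volume.restrict Ω)

/-- `(u, G) ∈ QH₀^{1,p}(v, Ω)`: the pair lies in `L^p(v, Ω) × QL^p(Ω)` and is the limit there of
pairs `(ψ_j, ∇ψ_j)` with `ψ_j ∈ Lip₀(Ω)`. -/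
def MemQH0 {n : ℕ} (Ω : Set (EuclideanSpace ℝ (Fin n))) (v : EuclideanSpace ℝ (Fin n) → ℝ)
    (Q : EuclideanSpace ℝ (Fin n) → Matrix (Fin n) (Fin n) ℝ) (p : ℝ)
    (u : EuclideanSpace ℝ (Fin n) → ℝ)
    (G : EuclideanSpace ℝ (Fin n) → EuclideanSpace ℝ (Fin n)) : Prop :=
  MemLp u (ENNReal.ofReal p) (weightMeasure v Ω) ∧
  AEMeasurable G (volume.restrict Ω) ∧ matrixNorm Q p Ω G < ∞ ∧
  ∃ ψ : ℕ → EuclideanSpace ℝ (Fin n) → ℝ, (∀ j, IsLipZero Ω (ψ j)) ∧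
    Tendsto (fun j => eLpNorm (fun x => ψ j x - u x) (ENNReal.ofReal p) (weightMeasure v Ω))
      atTop (𝓝 0) ∧
    Tendsto (fun j => matrixNorm Q p Ω (fun x => gradient (ψ j) x - G x)) atTop (𝓝 0)

/-- The Sobolev inequality `‖φ‖_{L^N(v,Ω)} ≤ S ‖∇φ‖_{QL^p(Ω)}` for all `φ ∈ Lip₀(Ω)`. -/
def SobolevInequality {n : ℕ} (Ω : Set (EuclideanSpace ℝ (Fin n)))
    (v : EuclideanSpace ℝ (Fin n) → ℝ)
    (Q : EuclideanSpace ℝ (Fin n) → Matrix (Fin n) (Fin n) ℝ) (p : ℝ) (N : ℝ → ℝ) (S : ℝ≥0) :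
    Prop :=
  ∀ φ : EuclideanSpace ℝ (Fin n) → ℝ, IsLipZero Ω φ →
    luxemburgNorm N (weightMeasure v Ω) φ ≤ S * matrixNorm Q p Ω (gradient φ)

/-- `t · ∇` is a degenerate subunit vector field with constant `K`:
`‖t · ∇φ‖_{L^p(v,Ω)} ≤ K ‖∇φ‖_{QL^p(Ω)}` for all `φ ∈ Lip₀(Ω)`. -/
def IsSubunit {n : ℕ} (Ω : Set (EuclideanSpace ℝ (Fin n)))
    (v : EuclideanSpace ℝ (Fin n) → ℝ)
    (Q : EuclideanSpace ℝ (Fin n) → Matrix (Fin n) (Fin n) ℝ) (p : ℝ)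
    (t : EuclideanSpace ℝ (Fin n) → EuclideanSpace ℝ (Fin n)) (K : ℝ≥0) : Prop :=
  ∀ φ : EuclideanSpace ℝ (Fin n) → ℝ, IsLipZero Ω φ →
    eLpNorm (fun x => inner ℝ (t x) (gradient φ x)) (ENNReal.ofReal p) (weightMeasure v Ω)
      ≤ K * matrixNorm Q p Ω (gradient φ)

/-- `∫_Ω |√Q G|^{p-2} ∇φ · Q G dx`. -/
def weakLHS {n : ℕ} (Ω : Set (EuclideanSpace ℝ (Fin n)))
    (Q : EuclideanSpace ℝ (Fin n) → Matrix (Fin n) (Fin n) ℝ) (p : ℝ)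
    (G : EuclideanSpace ℝ (Fin n) → EuclideanSpace ℝ (Fin n))
    (φ : EuclideanSpace ℝ (Fin n) → ℝ) : ℝ :=
  ∫ x in Ω, sqrtMulNorm (Q x) (G x) ^ (p - 2) *
    inner ℝ (gradient φ x) (Matrix.toEuclideanCLM (𝕜 := ℝ) (Q x) (G x))

/-- `∫_Ω (f |f|^{p-2} φ + |g|^{p-2} g t · ∇φ) v dx`. -/
def weakRHS {n : ℕ} (Ω : Set (EuclideanSpace ℝ (Fin n)))
    (v : EuclideanSpace ℝ (Fin n) → ℝ) (p : ℝ)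
    (t : EuclideanSpace ℝ (Fin n) → EuclideanSpace ℝ (Fin n))
    (f g φ : EuclideanSpace ℝ (Fin n) → ℝ) : ℝ :=
  ∫ x, (f x * |f x| ^ (p - 2) * φ x +
    |g x| ^ (p - 2) * g x * inner ℝ (t x) (gradient φ x)) ∂(weightMeasure v Ω)

/-- `(u, G)` is a degenerate weak subsolution of the Dirichlet problem. -/
def IsWeakSubsolution {n : ℕ} (Ω : Set (EuclideanSpace ℝ (Fin n)))
    (v : EuclideanSpace ℝ (Fin n) → ℝ)
    (Q : EuclideanSpace ℝ (Fin n) → Matrix (Fin n) (Fin n) ℝ) (p : ℝ)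
    (t : EuclideanSpace ℝ (Fin n) → EuclideanSpace ℝ (Fin n))
    (f g u : EuclideanSpace ℝ (Fin n) → ℝ)
    (G : EuclideanSpace ℝ (Fin n) → EuclideanSpace ℝ (Fin n)) : Prop :=
  MemQH0 Ω v Q p u G ∧
  ∀ φ : EuclideanSpace ℝ (Fin n) → ℝ, IsLipZero Ω φ → (∀ x, 0 ≤ φ x) →
    weakLHS Ω Q p G φ ≤ weakRHS Ω v p t f g φ

/-- `(u, G)` is a degenerate weak supersolution of the Dirichlet problem. -/
def IsWeakSupersolution {n : ℕ} (Ω : Set (EuclideanSpace ℝ (Fin n)))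
    (v : EuclideanSpace ℝ (Fin n) → ℝ)
    (Q : EuclideanSpace ℝ (Fin n) → Matrix (Fin n) (Fin n) ℝ) (p : ℝ)
    (t : EuclideanSpace ℝ (Fin n) → EuclideanSpace ℝ (Fin n))
    (f g u : EuclideanSpace ℝ (Fin n) → ℝ)
    (G : EuclideanSpace ℝ (Fin n) → EuclideanSpace ℝ (Fin n)) : Prop :=
  MemQH0 Ω v Q p u G ∧
  ∀ φ : EuclideanSpace ℝ (Fin n) → ℝ, IsLipZero Ω φ → (∀ x, 0 ≤ φ x) →
    weakRHS Ω v p t f g φ ≤ weakLHS Ω Q p G φ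

/-- `(u, G)` is a degenerate weak solution of the Dirichlet problem. -/
def IsWeakSolution {n : ℕ} (Ω : Set (EuclideanSpace ℝ (Fin n)))
    (v : EuclideanSpace ℝ (Fin n) → ℝ)
    (Q : EuclideanSpace ℝ (Fin n) → Matrix (Fin n) (Fin n) ℝ) (p : ℝ)
    (t : EuclideanSpace ℝ (Fin n) → EuclideanSpace ℝ (Fin n))
    (f g u : EuclideanSpace ℝ (Fin n) → ℝ)
    (G : EuclideanSpace ℝ (Fin n) → EuclideanSpace ℝ (Fin n)) : Prop :=
  MemQH0 Ω v Q p u G ∧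
  ∀ φ : EuclideanSpace ℝ (Fin n) → ℝ, IsLipZero Ω φ →
    weakLHS Ω Q p G φ = weakRHS Ω v p t f g φ

end

/-!
The proof is a De Giorgi iteration over the superlevel sets of `u`. Write `ν` for the measure `v dx`
and let `ψ_j` be the Lipschitz functions approximating the subsolution `u`.

*Testing.* The function `φ = (ψ_j - r)⁺` with `r ≥ 0` is an admissible test function, and its gradient
is the restriction of `∇ψ_j` to `E = {ψ_j > r}` (`gradient_truncation`). No chain rule for `u` itself
is needed, which matters because `∇u` need not be determined by `u`. With `X = ‖√Q ∇u‖_{L^p(E)}`, the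
weak formulation, Hölder's inequality, the Sobolev inequality and the subunit condition give, up to
an error which vanishes as `j → ∞`,
`X ^ (p - 1) ≤ (S ‖|f|^{p-1}‖_{L^{σ'}(E, ν)} + K ‖|g|^{p-1}‖_{L^{p'σ'}(E, ν)}) ν(E)^{(p-1)/(σp)}`,
and the Sobolev inequality bounds `φ` in `L^{σp}(ν)` by `S X` (`IsWeakSubsolution.truncation_energy`).

*The logarithmic gain.* If `ν(E) = O(e^{-k})`, the Orlicz bounds on `f` and `g` make the first factor
`O(D^{p-1} (k + 1)^{-q/σ'})`, where `D` bounds both Luxemburg norms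
(`exists_eLpNorm_restrict_rpow_le`).

*Iteration.* By Chebyshev's inequality and convergence in measure of `ψ_j` to `u`
(`IsWeakSubsolution.measure_superlevel_add_le`), raising the level by `c D (k + 1)^{-θ}`, with
`θ = q / (σ' (p - 1))`, reduces the bound on the measure of the superlevel set from `M e^{-k}` to
`M e^{-(k+1)}`. As `θ > 1` the levels converge to a multiple of `D`, and `u` is almost everywhere below
the limit (`exists_forall_isWeakSubsolution_le`). Supersolutions follow by changing all signs, and
solutions are both subsolutions and supersolutions.
-/

/-! ### Lipschitz test functions and their truncations -/

theorem IsLipZero.continuous {n : ℕ} {Ω : Set (EuclideanSpace ℝ (Fin n))} (hΩ : IsOpen Ω)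
    {φ : EuclideanSpace ℝ (Fin n) → ℝ} (hφ : IsLipZero Ω φ) : Continuous φ :=
  continuous_of_tsupport fun _ hx =>
    hφ.1.continuousOn.continuousAt (hΩ.mem_nhds (hφ.2.2 hx))

theorem IsLipZero.comp_lipschitz {n : ℕ} {Ω : Set (EuclideanSpace ℝ (Fin n))}
    {φ : EuclideanSpace ℝ (Fin n) → ℝ} (hφ : IsLipZero Ω φ) {η : ℝ → ℝ} {c : ℝ≥0}
    (hη : LipschitzWith c η) (hη0 : η 0 = 0) : IsLipZero Ω (fun x => η (φ x)) := by
  refine ⟨fun x hx => ?_, hφ.2.1.comp_left hη0, (tsupport_comp_subset hη0 φ).trans hφ.2.2⟩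
  obtain ⟨C, s, hs, hC⟩ := hφ.1 hx
  exact ⟨c * C, s, hs, hη.comp_lipschitzOnWith hC⟩

theorem IsLipZero.neg {n : ℕ} {Ω : Set (EuclideanSpace ℝ (Fin n))}
    {φ : EuclideanSpace ℝ (Fin n) → ℝ} (hφ : IsLipZero Ω φ) : IsLipZero Ω (fun x => -φ x) :=
  hφ.comp_lipschitz (η := fun s => -s) (c := 1)
    (LipschitzWith.of_dist_le_mul fun x y => by simp [dist_neg_neg]) neg_zero

theorem IsLipZero.truncation {n : ℕ} {Ω : Set (EuclideanSpace ℝ (Fin n))}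
    {φ : EuclideanSpace ℝ (Fin n) → ℝ} (hφ : IsLipZero Ω φ) {r : ℝ} (hr : 0 ≤ r) :
    IsLipZero Ω (fun x => max (φ x - r) 0) :=
  hφ.comp_lipschitz (η := fun s => max (s - r) 0) (c := 1)
    (LipschitzWith.of_dist_le_mul fun x y => by
      simp only [Real.dist_eq, NNReal.coe_one, one_mul]
      exact (abs_max_sub_max_le_abs _ _ _).trans (by simp)) (by simp [hr])

/-- The gradient of `(ψ - r)⁺` at every point, including those of `{ψ = r}`: there `(ψ - r)⁺` has a
local minimum, so its gradient vanishes if it exists, and `gradient` is zero by convention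
otherwise. -/
theorem gradient_truncation {F : Type*} [NormedAddCommGroup F] [InnerProductSpace ℝ F]
    [CompleteSpace F] {ψ : F → ℝ} (hψ : Continuous ψ) (r : ℝ) :
    gradient (fun y => max (ψ y - r) 0) = {y | r < ψ y}.indicator (gradient ψ) := by
  funext x
  by_cases hx : r < ψ x
  · rw [indicator_of_mem (show x ∈ {y | r < ψ y} from hx)]
    have h : (fun y => max (ψ y - r) 0) =ᶠ[𝓝 x] fun y => ψ y - r := by
      filter_upwards [hψ.continuousAt.eventually (lt_mem_nhds hx)] with y hy
      exact max_eq_left (sub_nonneg.2 hy.le)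
    simp only [gradient, h.fderiv_eq, fderiv_sub_const]
  · rw [indicator_of_notMem (show x ∉ {y | r < ψ y} from hx)]
    have h : IsLocalMin (fun y => max (ψ y - r) 0) x := by
      refine Eventually.of_forall fun y => ?_
      have : max (ψ x - r) 0 = 0 := max_eq_right (by linarith [not_lt.1 hx])
      simp only [this]
      exact le_max_right _ _
    simp only [gradient, h.fderiv_eq_zero, map_zero]

theorem gradient_neg' {F : Type*} [NormedAddCommGroup F] [InnerProductSpace ℝ F]
    [CompleteSpace F] (ψ : F → ℝ) (x : F) :
    gradient (fun y => -ψ y) x = -gradient ψ x := by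
  simp only [gradient]
  rw [show (fun y => -ψ y) = -ψ from rfl, fderiv_neg, map_neg]

theorem measurable_gradient {F : Type*} [NormedAddCommGroup F] [InnerProductSpace ℝ F]
    [CompleteSpace F] [MeasurableSpace F] [BorelSpace F] (ψ : F → ℝ) :
    Measurable (gradient ψ) :=
  (InnerProductSpace.toDual ℝ F).symm.continuous.measurable.comp (measurable_fderiv ℝ ψ)

/-! ### The seminorm given by the matrix -/

theorem sqrtMulNorm_nonneg {n : ℕ} (M : Matrix (Fin n) (Fin n) ℝ)
    (ξ : EuclideanSpace ℝ (Fin n)) : 0 ≤ sqrtMulNorm M ξ := norm_nonneg _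

theorem sqrtMulNorm_zero {n : ℕ} (M : Matrix (Fin n) (Fin n) ℝ) : sqrtMulNorm M 0 = 0 := by
  simp [sqrtMulNorm]

theorem sqrtMulNorm_neg {n : ℕ} (M : Matrix (Fin n) (Fin n) ℝ)
    (ξ : EuclideanSpace ℝ (Fin n)) : sqrtMulNorm M (-ξ) = sqrtMulNorm M ξ := by
  simp [sqrtMulNorm]

theorem sqrtMulNorm_le_add {n : ℕ} (M : Matrix (Fin n) (Fin n) ℝ)
    (ξ η : EuclideanSpace ℝ (Fin n)) :
    sqrtMulNorm M ξ ≤ sqrtMulNorm M η + sqrtMulNorm M (ξ - η) := by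
  unfold sqrtMulNorm
  calc _ = ‖Matrix.toEuclideanCLM (𝕜 := ℝ) (CFC.sqrt M) η
        + Matrix.toEuclideanCLM (𝕜 := ℝ) (CFC.sqrt M) (ξ - η)‖ := by
        rw [← map_add, add_sub_cancel]
    _ ≤ _ := norm_add_le _ _

theorem abs_inner_mul_le_sqrtMulNorm {n : ℕ} {M : Matrix (Fin n) (Fin n) ℝ} (hM : M.PosSemidef)
    (ξ η : EuclideanSpace ℝ (Fin n)) :
    |inner ℝ ξ (Matrix.toEuclideanCLM (𝕜 := ℝ) M η)| ≤ sqrtMulNorm M ξ * sqrtMulNorm M η := by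
  have hs : star (CFC.sqrt M) = CFC.sqrt M :=
    (IsSelfAdjoint.of_nonneg (CFC.sqrt_nonneg M)).star_eq
  have h2 : CFC.sqrt M * CFC.sqrt M = M := CFC.sqrt_mul_sqrt_self M hM.nonneg
  have h : inner ℝ ξ (Matrix.toEuclideanCLM (𝕜 := ℝ) M η) =
      inner ℝ (Matrix.toEuclideanCLM (𝕜 := ℝ) (CFC.sqrt M) ξ)
        (Matrix.toEuclideanCLM (𝕜 := ℝ) (CFC.sqrt M) η) := by
    conv_lhs => rw [← h2, map_mul]
    rw [mul_apply_eq_comp]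
    conv_lhs => rw [← ContinuousLinearMap.adjoint_inner_left, ← ContinuousLinearMap.star_eq_adjoint,
      ← map_star, hs]
  rw [h]
  exact abs_real_inner_le_norm _ _

theorem aemeasurable_inner_toEuclideanCLM {n : ℕ} {μ : Measure (EuclideanSpace ℝ (Fin n))}
    {Q : EuclideanSpace ℝ (Fin n) → Matrix (Fin n) (Fin n) ℝ}
    (hQ : ∀ i j, AEMeasurable (fun x => Q x i j) μ)
    {H G : EuclideanSpace ℝ (Fin n) → EuclideanSpace ℝ (Fin n)}
    (hH : AEMeasurable H μ) (hG : AEMeasurable G μ) :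
    AEMeasurable (fun x => inner ℝ (H x) (Matrix.toEuclideanCLM (𝕜 := ℝ) (Q x) (G x))) μ := by
  have hc : ∀ {H : EuclideanSpace ℝ (Fin n) → EuclideanSpace ℝ (Fin n)}, AEMeasurable H μ →
      ∀ i, AEMeasurable (fun x => H x i) μ := fun hH i =>
    (EuclideanSpace.proj (𝕜 := ℝ) i).continuous.measurable.comp_aemeasurable hH
  simp only [PiLp.inner_apply, Matrix.ofLp_toEuclideanCLM, Matrix.mulVec, dotProduct]
  refine Finset.aemeasurable_fun_sum _ fun i _ => ?_
  simp only [RCLike.inner_apply, conj_trivial]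
  exact (Finset.aemeasurable_fun_sum _ fun j _ => (hQ i j).mul (hc hG j)).mul (hc hH i)

theorem aemeasurable_sqrtMulNorm {n : ℕ} {μ : Measure (EuclideanSpace ℝ (Fin n))}
    {Q : EuclideanSpace ℝ (Fin n) → Matrix (Fin n) (Fin n) ℝ}
    (hQ : ∀ i j, AEMeasurable (fun x => Q x i j) μ) (hpos : ∀ᵐ x ∂μ, (Q x).PosSemidef)
    {H : EuclideanSpace ℝ (Fin n) → EuclideanSpace ℝ (Fin n)} (hH : AEMeasurable H μ) :
    AEMeasurable (fun x => sqrtMulNorm (Q x) (H x)) μ := by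
  refine (aemeasurable_inner_toEuclideanCLM hQ hH hH).sqrt.congr ?_
  filter_upwards [hpos] with x hx
  rw [← sqrtMulNorm_sq hx, Real.sqrt_sq (sqrtMulNorm_nonneg _ _)]

/-! ### Lebesgue norms -/

theorem eLpNorm_le_luxemburgNorm_powerFun {X : Type*} [MeasurableSpace X] {ν : Measure X} {r : ℝ}
    (hr : 0 < r) (h : X → ℝ) :
    eLpNorm h (ENNReal.ofReal r) ν ≤ luxemburgNorm (powerFun r) ν h := by
  refine le_iInf fun lam => le_iInf fun hlam => le_iInf fun hle => ?_
  rw [eLpNorm_eq_lintegral_rpow_enorm_toReal (by simpa using hr) ENNReal.ofReal_ne_top,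
    ENNReal.toReal_ofReal hr.le]
  have hpt : ∀ x, ‖h x‖ₑ ^ r =
      ENNReal.ofReal lam ^ r * ENNReal.ofReal (powerFun r (|h x| / lam)) := fun x => by
    rw [powerFun, ← ENNReal.ofReal_rpow_of_nonneg (by positivity) hr.le,
      ← ENNReal.mul_rpow_of_nonneg _ _ hr.le, ← ENNReal.ofReal_mul hlam.le,
      mul_div_cancel₀ _ hlam.ne', ← Real.enorm_eq_ofReal_abs]
  simp_rw [hpt]
  rw [lintegral_const_mul' _ _ (ENNReal.rpow_ne_top_of_nonneg hr.le ENNReal.ofReal_ne_top)]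
  calc _ ≤ (ENNReal.ofReal lam ^ r * 1) ^ (1 / r) := by gcongr
    _ = ENNReal.ofReal lam := by
      rw [mul_one, one_div, ENNReal.rpow_rpow_inv hr.ne']

theorem integral_rpow_eq_eLpNorm_toReal_rpow {X : Type*} [MeasurableSpace X] {μ : Measure X}
    {p : ℝ} (hp : 0 < p) {f : X → ℝ} (hf : MemLp f (ENNReal.ofReal p) μ) (h0 : ∀ x, 0 ≤ f x) :
    ∫ x, f x ^ p ∂μ = (eLpNorm f (ENNReal.ofReal p) μ).toReal ^ p := by
  have hnn : 0 ≤ ∫ x, f x ^ p ∂μ := integral_nonneg fun x => Real.rpow_nonneg (h0 x) _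
  rw [hf.eLpNorm_eq_integral_rpow_norm (by simpa using hp) ENNReal.ofReal_ne_top,
    ENNReal.toReal_ofReal hp.le]
  simp only [Real.norm_of_nonneg (h0 _)]
  rw [ENNReal.toReal_ofReal (Real.rpow_nonneg hnn _), Real.rpow_inv_rpow hnn hp.ne']

/-- Hölder's inequality when the second factor vanishes off `E`. -/
theorem lintegral_enorm_mul_le_of_eq_zero {X : Type*} [MeasurableSpace X] {ν : Measure X}
    {p p' : ℝ} (hpp : p.HolderConjugate p') {E : Set X} (hE : MeasurableSet E) {h φ : X → ℝ}
    (hh : AEMeasurable h ν) (hφ : AEMeasurable φ ν) (h0 : ∀ x ∉ E, φ x = 0) :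
    ∫⁻ x, ‖h x * φ x‖ₑ ∂ν ≤
      eLpNorm h (ENNReal.ofReal p') (ν.restrict E) * eLpNorm φ (ENNReal.ofReal p) ν := by
  have : ENNReal.HolderConjugate (ENNReal.ofReal p') (ENNReal.ofReal p) :=
    hpp.symm.ennrealOfReal
  calc ∫⁻ x, ‖h x * φ x‖ₑ ∂ν = ∫⁻ x in E, ‖h x * φ x‖ₑ ∂ν := by
        rw [← lintegral_indicator hE]
        refine lintegral_congr fun x => ?_
        by_cases hx : x ∈ E
        · rw [indicator_of_mem hx]
        · rw [indicator_of_notMem hx, h0 x hx, mul_zero, enorm_zero]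
    _ = eLpNorm (h • φ) 1 (ν.restrict E) := by
        rw [eLpNorm_one_eq_lintegral_enorm]; rfl
    _ ≤ eLpNorm h (ENNReal.ofReal p') (ν.restrict E) *
        eLpNorm φ (ENNReal.ofReal p) (ν.restrict E) :=
        eLpNorm_smul_le_mul_eLpNorm hφ.aestronglyMeasurable.restrict
          hh.aestronglyMeasurable.restrict
    _ ≤ _ := by gcongr; exact Measure.restrict_le_self

/-- Comparison of Lebesgue norms on a set of finite measure. -/
theorem eLpNorm_restrict_le_mul_rpow {X : Type*} [MeasurableSpace X] {ν : Measure X}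
    {a b : ℝ} (ha : 0 < a) (hab : a ≤ b) {E : Set X} {h : X → ℝ} (hh : AEMeasurable h ν) :
    eLpNorm h (ENNReal.ofReal a) (ν.restrict E) ≤
      eLpNorm h (ENNReal.ofReal b) (ν.restrict E) * ν E ^ (1 / a - 1 / b) := by
  have := eLpNorm_le_eLpNorm_mul_rpow_measure_univ (μ := ν.restrict E)
    (ENNReal.ofReal_le_ofReal hab) hh.aestronglyMeasurable.restrict
  rwa [ENNReal.toReal_ofReal ha.le, ENNReal.toReal_ofReal (ha.le.trans hab),
    Measure.restrict_apply_univ] at this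

/-- Chebyshev's inequality for a truncation. -/
theorem ofReal_sub_mul_measure_rpow_le {X : Type*} [MeasurableSpace X] {ν : Measure X}
    {a r s : ℝ} (ha : 0 < a) {ψ : X → ℝ} (hψ : AEMeasurable ψ ν) :
    ENNReal.ofReal (s - r) * ν {x | s < ψ x} ^ (1 / a) ≤
      eLpNorm (fun x => max (ψ x - r) 0) (ENNReal.ofReal a) ν := by
  have h := mul_meas_ge_le_pow_eLpNorm' ν (p := ENNReal.ofReal a) (by simpa using ha)
    ENNReal.ofReal_ne_top (f := fun x => max (ψ x - r) 0)
    ((hψ.sub_const r).max aemeasurable_const).aestronglyMeasurable (ENNReal.ofReal (s - r))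
  rw [ENNReal.toReal_ofReal ha.le] at h
  have hsub : ν {x | s < ψ x} ≤ ν {x | ENNReal.ofReal (s - r) ≤ ‖max (ψ x - r) 0‖ₑ} := by
    refine measure_mono fun x hx => ?_
    simp only [mem_ofPred_eq] at hx ⊢
    rw [Real.enorm_eq_ofReal (le_max_right _ _)]
    exact ENNReal.ofReal_le_ofReal (le_max_of_le_left (by linarith))
  rw [← ENNReal.rpow_le_rpow_iff ha, ENNReal.mul_rpow_of_nonneg _ _ ha.le, one_div,
    ENNReal.rpow_inv_rpow ha.ne']
  exact (by gcongr : _ ≤ _).trans h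

/-! ### The energy inequality on a superlevel set -/

/-- Lower bound for the left-hand side of the weak formulation when the gradient of the test
function is the restriction to `E` of a field `H` close to `G`. -/
theorem energy_sub_le_integral {n : ℕ} {μ : Measure (EuclideanSpace ℝ (Fin n))}
    {Q : EuclideanSpace ℝ (Fin n) → Matrix (Fin n) (Fin n) ℝ}
    (hQ : ∀ i j, AEMeasurable (fun x => Q x i j) μ) (hpos : ∀ᵐ x ∂μ, (Q x).PosSemidef)
    {p : ℝ} (hp : 1 < p) {E : Set (EuclideanSpace ℝ (Fin n))} (hE : MeasurableSet E)
    {H G : EuclideanSpace ℝ (Fin n) → EuclideanSpace ℝ (Fin n)}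
    (hH : AEMeasurable H μ) (hG : AEMeasurable G μ)
    (hs : MemLp (fun x => sqrtMulNorm (Q x) (G x)) (ENNReal.ofReal p) μ)
    (hw : MemLp (fun x => sqrtMulNorm (Q x) (H x - G x)) (ENNReal.ofReal p) μ) :
    (eLpNorm (fun x => sqrtMulNorm (Q x) (G x)) (ENNReal.ofReal p) (μ.restrict E)).toReal ^ p
      - (eLpNorm (fun x => sqrtMulNorm (Q x) (G x)) (ENNReal.ofReal p) μ).toReal ^ (p - 1)
        * (eLpNorm (fun x => sqrtMulNorm (Q x) (H x - G x)) (ENNReal.ofReal p) μ).toReal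
    ≤ ∫ x, sqrtMulNorm (Q x) (G x) ^ (p - 2) *
      inner ℝ (E.indicator H x) (Matrix.toEuclideanCLM (𝕜 := ℝ) (Q x) (G x)) ∂μ := by
  have hp0 : 0 < p := by linarith
  have hp1 : 0 < p - 1 := by linarith
  have hpq : p.conjExponent.HolderConjugate p := (Real.HolderConjugate.conjExponent hp).symm
  set s := fun x => sqrtMulNorm (Q x) (G x) with hsdef
  set w := fun x => sqrtMulNorm (Q x) (H x - G x) with hwdef
  have hs0 : ∀ x, 0 ≤ s x := fun x => sqrtMulNorm_nonneg _ _
  have hw0 : ∀ x, 0 ≤ w x := fun x => sqrtMulNorm_nonneg _ _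
  have hsm : AEMeasurable s μ := aemeasurable_sqrtMulNorm hQ hpos hG
  have hconj : p.conjExponent * (p - 1) = p := by
    rw [Real.conjExponent]; field_simp
  -- `s ^ (p - 1)` lies in the dual Lebesgue space
  have hsp : MemLp (fun x => s x ^ (p - 1)) (ENNReal.ofReal p.conjExponent) μ := by
    refine ⟨(hsm.pow_const _).aestronglyMeasurable, ?_⟩
    have h1 : eLpNorm (fun x => ‖s x‖ ^ (p - 1)) (ENNReal.ofReal p.conjExponent) μ =
        eLpNorm s (ENNReal.ofReal p) μ ^ (p - 1) := by
      rw [eLpNorm_norm_rpow _ hp1, ← ENNReal.ofReal_mul hpq.pos.le, hconj]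
    simp only [Real.norm_of_nonneg (hs0 _)] at h1
    rw [h1]
    exact ENNReal.rpow_lt_top_of_nonneg hp1.le hs.2.ne
  have hhol : ENNReal.HolderConjugate (ENNReal.ofReal p.conjExponent) (ENNReal.ofReal p) :=
    hpq.ennrealOfReal
  have hint_s : Integrable (fun x => s x ^ (p - 1) * s x) μ := hsp.integrable_mul hs
  have hint_w : Integrable (fun x => s x ^ (p - 1) * w x) μ := hsp.integrable_mul hw
  have hspp : ∀ x, s x ^ (p - 1) * s x = s x ^ p := fun x => by
    rcases (hs0 x).eq_or_lt with h | h
    · rw [← h, Real.zero_rpow hp1.ne', Real.zero_rpow hp0.ne', zero_mul]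
    · rw [← Real.rpow_add_one h.ne', sub_add_cancel]
  have hsp2 : ∀ x, s x ^ (p - 2) * s x = s x ^ (p - 1) := fun x => by
    rcases (hs0 x).eq_or_lt with h | h
    · rw [← h, Real.zero_rpow hp1.ne', mul_zero]
    · rw [← Real.rpow_add_one h.ne']; congr 1; ring
  -- pointwise lower bound on the integrand, from the splitting `H = G + (H - G)`
  have hlow : ∀ᵐ x ∂μ, E.indicator (fun x => s x ^ (p - 1) * s x) x - s x ^ (p - 1) * w x ≤
      s x ^ (p - 2) *
        inner ℝ (E.indicator H x) (Matrix.toEuclideanCLM (𝕜 := ℝ) (Q x) (G x)) := by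
    filter_upwards [hpos] with x hx
    by_cases hxE : x ∈ E
    · rw [indicator_of_mem hxE, indicator_of_mem hxE]
      have hsplit : inner ℝ (H x) (Matrix.toEuclideanCLM (𝕜 := ℝ) (Q x) (G x)) =
          s x * s x
          + inner ℝ (H x - G x) (Matrix.toEuclideanCLM (𝕜 := ℝ) (Q x) (G x)) := by
        rw [inner_sub_left, ← sqrtMulNorm_sq hx]; simp only [hsdef]; ring
      have hcs := (abs_le.1 (abs_inner_mul_le_sqrtMulNorm hx (H x - G x) (G x))).1
      have hn : 0 ≤ s x ^ (p - 2) := Real.rpow_nonneg (hs0 x) _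
      rw [hsplit, ← hsp2]
      have := mul_le_mul_of_nonneg_left hcs hn
      simp only [hsdef, hwdef] at this ⊢
      linarith
    · rw [indicator_of_notMem hxE, indicator_of_notMem hxE, inner_zero_left, mul_zero, zero_sub]
      exact neg_nonpos.2 (mul_nonneg (Real.rpow_nonneg (hs0 x) _) (hw0 x))
  have hup : ∀ᵐ x ∂μ, ‖s x ^ (p - 2) *
        inner ℝ (E.indicator H x) (Matrix.toEuclideanCLM (𝕜 := ℝ) (Q x) (G x))‖ ≤
      s x ^ (p - 1) * s x + s x ^ (p - 1) * w x := by
    filter_upwards [hpos] with x hx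
    rw [norm_mul, Real.norm_of_nonneg (Real.rpow_nonneg (hs0 x) _), ← mul_add, ← hsp2, mul_assoc]
    refine mul_le_mul_of_nonneg_left ?_ (Real.rpow_nonneg (hs0 x) _)
    refine (abs_inner_mul_le_sqrtMulNorm hx _ _).trans ?_
    rw [mul_comm (s x)]
    refine mul_le_mul_of_nonneg_right ?_ (hs0 x)
    by_cases hxE : x ∈ E
    · rw [indicator_of_mem hxE]; exact sqrtMulNorm_le_add _ _ _
    · rw [indicator_of_notMem hxE, sqrtMulNorm_zero]; exact add_nonneg (hs0 x) (hw0 x)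
  have hint : Integrable (fun x => s x ^ (p - 2) *
      inner ℝ (E.indicator H x) (Matrix.toEuclideanCLM (𝕜 := ℝ) (Q x) (G x))) μ :=
    (hint_s.add hint_w).mono'
      ((hsm.pow_const _).mul
        (aemeasurable_inner_toEuclideanCLM hQ (hH.indicator hE) hG)).aestronglyMeasurable hup
  have hmono := integral_mono_ae ((hint_s.indicator hE).sub hint_w) hint hlow
  simp only [Pi.sub_apply] at hmono
  rw [integral_sub (hint_s.indicator hE) hint_w, integral_indicator hE] at hmono
  simp only [hspp] at hmono
  rw [integral_rpow_eq_eLpNorm_toReal_rpow hp0 (hs.restrict E) hs0] at hmono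
  have hH' := integral_mul_le_Lp_mul_Lq_of_nonneg hpq
    (ae_of_all μ fun x => Real.rpow_nonneg (hs0 x) (p - 1)) (ae_of_all μ hw0) hsp hw
  have hpow : ∀ x, (s x ^ (p - 1)) ^ p.conjExponent = s x ^ p := fun x => by
    rw [← Real.rpow_mul (hs0 x), mul_comm, hconj]
  simp only [hpow] at hH'
  rw [integral_rpow_eq_eLpNorm_toReal_rpow hp0 hs hs0,
    integral_rpow_eq_eLpNorm_toReal_rpow hp0 hw hw0, ← Real.rpow_mul ENNReal.toReal_nonneg,
    ← Real.rpow_mul ENNReal.toReal_nonneg, mul_one_div_cancel hp0.ne', Real.rpow_one,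
    show p * (1 / p.conjExponent) = p - 1 by rw [Real.conjExponent]; field_simp] at hH'
  linarith

/-- Upper bound for the right-hand side of the weak formulation when the test function and its
derivative along `t` vanish off `E`. -/
theorem ofReal_integral_le_of_eq_zero {X : Type*} [MeasurableSpace X] {ν : Measure X}
    {p a : ℝ} (hp : 1 < p) (ha : 1 < a) {E : Set X} (hE : MeasurableSet E) {f g φ τ : X → ℝ}
    (hf : AEMeasurable f ν) (hg : AEMeasurable g ν) (hφ : AEMeasurable φ ν)
    (hτ : AEMeasurable τ ν) (hφ0 : ∀ x ∉ E, φ x = 0) (hτ0 : ∀ x ∉ E, τ x = 0) :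
    ENNReal.ofReal (∫ x, (f x * |f x| ^ (p - 2) * φ x + |g x| ^ (p - 2) * g x * τ x) ∂ν) ≤
      eLpNorm (fun x => |f x| ^ (p - 1)) (ENNReal.ofReal a.conjExponent) (ν.restrict E) *
        eLpNorm φ (ENNReal.ofReal a) ν +
      eLpNorm (fun x => |g x| ^ (p - 1)) (ENNReal.ofReal p.conjExponent) (ν.restrict E) *
        eLpNorm τ (ENNReal.ofReal p) ν := by
  have hpow : ∀ y : ℝ, ‖y * |y| ^ (p - 2)‖ₑ = ‖|y| ^ (p - 1)‖ₑ := fun y => by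
    rw [← ofReal_norm, ← ofReal_norm]
    congr 1
    rw [norm_mul, Real.norm_of_nonneg (Real.rpow_nonneg (abs_nonneg y) _),
      Real.norm_of_nonneg (Real.rpow_nonneg (abs_nonneg y) _), Real.norm_eq_abs]
    rcases (abs_nonneg y).eq_or_lt with h | h
    · rw [← h, zero_mul, Real.zero_rpow (by linarith)]
    · rw [mul_comm, ← Real.rpow_add_one h.ne']; congr 1; ring
  have hm : ∀ {h : X → ℝ}, AEMeasurable h ν → AEMeasurable (fun x => |h x| ^ (p - 1)) ν :=
    fun hh => hh.abs.pow_const _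
  calc _ ≤ ‖∫ x, (f x * |f x| ^ (p - 2) * φ x + |g x| ^ (p - 2) * g x * τ x) ∂ν‖ₑ := by
        rw [← ofReal_norm]; exact ENNReal.ofReal_le_ofReal (le_abs_self _)
    _ ≤ ∫⁻ x, ‖f x * |f x| ^ (p - 2) * φ x + |g x| ^ (p - 2) * g x * τ x‖ₑ ∂ν :=
        enorm_integral_le_lintegral_enorm _
    _ ≤ ∫⁻ x, (‖|f x| ^ (p - 1) * φ x‖ₑ + ‖|g x| ^ (p - 1) * τ x‖ₑ) ∂ν := by
        refine lintegral_mono fun x => (enorm_add_le _ _).trans (le_of_eq ?_)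
        rw [enorm_mul, hpow, ← enorm_mul, enorm_mul (_ * _) (τ x), mul_comm _ (g x), hpow,
          ← enorm_mul]
    _ = ∫⁻ x, ‖|f x| ^ (p - 1) * φ x‖ₑ ∂ν + ∫⁻ x, ‖|g x| ^ (p - 1) * τ x‖ₑ ∂ν :=
        lintegral_add_left' ((hm hf).mul hφ).enorm _
    _ ≤ _ := by
        gcongr
        · exact lintegral_enorm_mul_le_of_eq_zero (Real.HolderConjugate.conjExponent ha) hE
            (hm hf) hφ hφ0
        · exact lintegral_enorm_mul_le_of_eq_zero (Real.HolderConjugate.conjExponent hp) hE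
            (hm hg) hτ hτ0

/-- Energy inequality of a subsolution on a superlevel set of an approximating function. With
`X = ‖√Q G‖_{L^p(E)}`, `E = {ψ > r}`, `W = ‖∇ψ - G‖_{QL^p}` and `b` bounding the data on `E`,
testing with `(ψ - r)⁺` gives `X ^ p ≤ b X + O(W)`; the Sobolev inequality bounds
`(ψ - r)⁺` by `X + W`. -/
theorem IsWeakSubsolution.truncation_energy {n : ℕ} {Ω : Set (EuclideanSpace ℝ (Fin n))}
    (hΩ : IsOpen Ω) {v : EuclideanSpace ℝ (Fin n) → ℝ} {p σ : ℝ} (hp : 1 < p) (hσ : 1 < σ)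
    {t : EuclideanSpace ℝ (Fin n) → EuclideanSpace ℝ (Fin n)}
    (ht : AEMeasurable t (volume.restrict Ω)) {S K : ℝ≥0}
    {Q : EuclideanSpace ℝ (Fin n) → Matrix (Fin n) (Fin n) ℝ}
    (hQ : ∀ i j, AEMeasurable (fun x => Q x i j) (volume.restrict Ω))
    (hpos : ∀ x ∈ Ω, (Q x).PosSemidef)
    (hSob : SobolevInequality Ω v Q p (powerFun (σ * p)) S) (hSub : IsSubunit Ω v Q p t K)
    {f g u : EuclideanSpace ℝ (Fin n) → ℝ} {G : EuclideanSpace ℝ (Fin n) → EuclideanSpace ℝ (Fin n)}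
    (hf : AEMeasurable f (weightMeasure v Ω)) (hg : AEMeasurable g (weightMeasure v Ω))
    (hu : IsWeakSubsolution Ω v Q p t f g u G)
    {ψ : EuclideanSpace ℝ (Fin n) → ℝ} (hψ : IsLipZero Ω ψ)
    (hW : matrixNorm Q p Ω (fun x => gradient ψ x - G x) < ∞)
    {r b : ℝ} (hr : 0 ≤ r) (hb : 0 ≤ b)
    (hdata : (S * eLpNorm (fun x => |f x| ^ (p - 1)) (ENNReal.ofReal σ.conjExponent)
          ((weightMeasure v Ω).restrict {x | r < ψ x})
        + K * eLpNorm (fun x => |g x| ^ (p - 1))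
          (ENNReal.ofReal (p.conjExponent * σ.conjExponent))
          ((weightMeasure v Ω).restrict {x | r < ψ x}))
        * weightMeasure v Ω {x | r < ψ x} ^ ((p - 1) / (σ * p)) ≤ ENNReal.ofReal b) :
    (eLpNorm (fun x => sqrtMulNorm (Q x) (G x)) (ENNReal.ofReal p)
        ((volume.restrict Ω).restrict {x | r < ψ x})).toReal ^ p
      - (matrixNorm Q p Ω G).toReal ^ (p - 1)
        * (matrixNorm Q p Ω (fun x => gradient ψ x - G x)).toReal ≤
      b * ((eLpNorm (fun x => sqrtMulNorm (Q x) (G x)) (ENNReal.ofReal p)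
        ((volume.restrict Ω).restrict {x | r < ψ x})).toReal +
        (matrixNorm Q p Ω (fun x => gradient ψ x - G x)).toReal) ∧
    eLpNorm (fun x => max (ψ x - r) 0) (ENNReal.ofReal (σ * p)) (weightMeasure v Ω) ≤
      S * ENNReal.ofReal ((eLpNorm (fun x => sqrtMulNorm (Q x) (G x)) (ENNReal.ofReal p)
        ((volume.restrict Ω).restrict {x | r < ψ x})).toReal +
        (matrixNorm Q p Ω (fun x => gradient ψ x - G x)).toReal) := by
  set E := {x | r < ψ x} with hEdef
  set ν := weightMeasure v Ω with hν
  set φ := fun x => max (ψ x - r) 0 with hφdef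
  have hp0 : 0 < p := by linarith
  have hψc := hψ.continuous hΩ
  have hE : MeasurableSet E := (isOpen_lt continuous_const hψc).measurableSet
  have hφ : IsLipZero Ω φ := hψ.truncation hr
  have hgrad : gradient φ = E.indicator (gradient ψ) := gradient_truncation hψc r
  have hposae : ∀ᵐ x ∂(volume.restrict Ω), (Q x).PosSemidef :=
    (ae_restrict_iff' hΩ.measurableSet).2 (ae_of_all _ hpos)
  have hGm := hu.1.2.1
  have hgm : AEMeasurable (gradient ψ) (volume.restrict Ω) := (measurable_gradient ψ).aemeasurable
  have hsm := aemeasurable_sqrtMulNorm hQ hposae hGm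
  have hwm := aemeasurable_sqrtMulNorm hQ hposae (hgm.sub hGm)
  have hs : MemLp (fun x => sqrtMulNorm (Q x) (G x)) (ENNReal.ofReal p) (volume.restrict Ω) :=
    ⟨hsm.aestronglyMeasurable, hu.1.2.2.1⟩
  have hw : MemLp (fun x => sqrtMulNorm (Q x) (gradient ψ x - G x)) (ENNReal.ofReal p)
      (volume.restrict Ω) := ⟨hwm.aestronglyMeasurable, hW⟩
  set X := eLpNorm (fun x => sqrtMulNorm (Q x) (G x)) (ENNReal.ofReal p)
        ((volume.restrict Ω).restrict E) with hX
  set W := matrixNorm Q p Ω (fun x => gradient ψ x - G x) with hWdef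
  have hXtop : X ≠ ∞ := (hs.restrict E).2.ne
  have hXW : ENNReal.ofReal (X.toReal + W.toReal) = X + W := by
    rw [ENNReal.ofReal_add ENNReal.toReal_nonneg ENNReal.toReal_nonneg,
      ENNReal.ofReal_toReal hXtop, ENNReal.ofReal_toReal hW.ne]
  -- the gradient of the truncation is controlled by `G` on `E`, up to the approximation error
  have hnorm : matrixNorm Q p Ω (gradient φ) ≤ X + W := by
    have h1 : matrixNorm Q p Ω (gradient φ) = eLpNorm (fun x => sqrtMulNorm (Q x) (gradient ψ x))
        (ENNReal.ofReal p) ((volume.restrict Ω).restrict E) := by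
      rw [← eLpNorm_indicator_eq_eLpNorm_restrict hE, matrixNorm, hgrad]
      congr 1
      funext x
      by_cases hx : x ∈ E
      · simp only [indicator_of_mem hx]
      · simp only [indicator_of_notMem hx, sqrtMulNorm_zero]
    rw [h1]
    calc _ ≤ eLpNorm ((fun x => sqrtMulNorm (Q x) (G x)) +
            fun x => sqrtMulNorm (Q x) (gradient ψ x - G x)) (ENNReal.ofReal p)
            ((volume.restrict Ω).restrict E) := by
          refine eLpNorm_mono_real fun x => ?_
          rw [Real.norm_of_nonneg (sqrtMulNorm_nonneg _ _)]
          exact sqrtMulNorm_le_add _ _ _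
      _ ≤ X + eLpNorm (fun x => sqrtMulNorm (Q x) (gradient ψ x - G x)) (ENNReal.ofReal p)
            ((volume.restrict Ω).restrict E) :=
          eLpNorm_add_le hs.1.restrict hw.1.restrict
            (by simpa using ENNReal.ofReal_le_ofReal hp.le)
      _ ≤ X + W := by
          gcongr
          exact eLpNorm_mono_measure _ Measure.restrict_le_self
  have hσp : 1 < σ * p := by nlinarith
  have hsob : eLpNorm φ (ENNReal.ofReal (σ * p)) ν ≤ S * (X + W) :=
    (eLpNorm_le_luxemburgNorm_powerFun (by linarith) φ).trans ((hSob φ hφ).trans (by gcongr))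
  refine ⟨?_, by rwa [hXW]⟩
  have hlhs := energy_sub_le_integral hQ hposae hp hE hgm hGm hs hw
  have htest : weakLHS Ω Q p G φ ≤ weakRHS Ω v p t f g φ := hu.2 φ hφ fun x => le_max_right _ _
  have hφE : ∀ x ∉ E, φ x = 0 := fun x hx => max_eq_right (by
    have : ψ x ≤ r := not_lt.1 hx
    linarith)
  have hτE : ∀ x ∉ E, inner ℝ (t x) (gradient φ x) = 0 := fun x hx => by
    rw [hgrad, indicator_of_notMem hx, inner_zero_right]
  have htν : AEMeasurable t ν := ht.mono_ac (withDensity_absolutelyContinuous _ _)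
  have hrhs := ofReal_integral_le_of_eq_zero (ν := ν) hp hσp hE hf hg
    (hφ.continuous hΩ).measurable.aemeasurable
    (htν.inner (measurable_gradient φ).aemeasurable) hφE hτE
  have hfin : ENNReal.ofReal (weakRHS Ω v p t f g φ) ≤
      ENNReal.ofReal (b * (X.toReal + W.toReal)) := by
    rw [ENNReal.ofReal_mul hb, hXW]
    refine hrhs.trans ?_
    have hσ' := Real.HolderConjugate.conjExponent hσ
    have hp' := Real.HolderConjugate.conjExponent hp
    have hf1 := eLpNorm_restrict_le_mul_rpow (ν := ν) (E := E) (a := (σ * p).conjExponent)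
      (b := σ.conjExponent) (Real.HolderConjugate.conjExponent hσp).symm.pos
      (by
        rw [Real.conjExponent, Real.conjExponent, div_le_div_iff₀ (by linarith) (by linarith)]
        nlinarith) (hf.abs.pow_const (p - 1))
    have hg1 := eLpNorm_restrict_le_mul_rpow (ν := ν) (E := E) (a := p.conjExponent)
      (b := p.conjExponent * σ.conjExponent) hp'.symm.pos
      (le_mul_of_one_le_right hp'.symm.pos.le hσ'.symm.lt.le) (hg.abs.pow_const (p - 1))
    have e1 : 1 / (σ * p).conjExponent - 1 / σ.conjExponent = (p - 1) / (σ * p) := by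
      have : σ * p - 1 ≠ 0 := by linarith
      have : σ - 1 ≠ 0 := by linarith
      rw [Real.conjExponent, Real.conjExponent]; field_simp; ring
    have e2 : 1 / p.conjExponent - 1 / (p.conjExponent * σ.conjExponent)
        = (p - 1) / (σ * p) := by
      have : p - 1 ≠ 0 := by linarith
      have : σ - 1 ≠ 0 := by linarith
      rw [Real.conjExponent, Real.conjExponent]; field_simp; ring
    rw [e1] at hf1
    rw [e2] at hg1
    calc _ ≤ (eLpNorm (fun x => |f x| ^ (p - 1)) (ENNReal.ofReal σ.conjExponent) (ν.restrict E)
            * ν E ^ ((p - 1) / (σ * p))) * (S * (X + W)) +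
          (eLpNorm (fun x => |g x| ^ (p - 1)) (ENNReal.ofReal (p.conjExponent * σ.conjExponent))
            (ν.restrict E) * ν E ^ ((p - 1) / (σ * p))) * (K * (X + W)) := by
          gcongr
          exact (hSub φ hφ).trans (by gcongr)
      _ = ((S * eLpNorm (fun x => |f x| ^ (p - 1)) (ENNReal.ofReal σ.conjExponent)
            (ν.restrict E) + K * eLpNorm (fun x => |g x| ^ (p - 1))
            (ENNReal.ofReal (p.conjExponent * σ.conjExponent)) (ν.restrict E))
            * ν E ^ ((p - 1) / (σ * p))) * (X + W) := by ring
      _ ≤ _ := by gcongr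
  have hbn : 0 ≤ b * (X.toReal + W.toReal) := by positivity
  have hfin' := (ENNReal.ofReal_le_ofReal_iff hbn).1 hfin
  rw [weakLHS, hgrad] at htest
  exact hlhs.trans (htest.trans hfin')

/-- If `X ^ p ≤ b X + (b + Y ^ (p - 1)) W` with `W` small, then `X` is at most of order
`b ^ (1 / (p - 1))`. -/
theorem exists_pos_add_le_of_rpow_sub_le {p b Y : ℝ} (hp : 1 < p) (hb : 0 < b) (hY : 0 ≤ Y) :
    ∃ δ : ℝ, 0 < δ ∧ ∀ X W : ℝ, 0 ≤ X → W ≤ δ → X ^ p - Y ^ (p - 1) * W ≤ b * (X + W) →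
      X + W ≤ 2 * (2 * b) ^ (1 / (p - 1)) := by
  set R := (2 * b) ^ (1 / (p - 1)) with hR
  have hp1 : 0 < p - 1 := by linarith
  have hR0 : 0 < R := Real.rpow_pos_of_pos (by linarith) _
  have hY' : 0 ≤ Y ^ (p - 1) := Real.rpow_nonneg hY _
  have hbY : 0 < b + Y ^ (p - 1) := by linarith
  refine ⟨min R (b * R / (b + Y ^ (p - 1))), by positivity, fun X W hX hW h => ?_⟩
  have hW1 : W ≤ R := hW.trans (min_le_left _ _)
  have hW2 : (b + Y ^ (p - 1)) * W ≤ b * R := by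
    have := hW.trans (min_le_right _ _)
    rw [le_div_iff₀ hbY] at this
    linarith
  have hXR : X ≤ R := by
    by_contra! hlt
    have hX0 : 0 < X := hR0.trans hlt
    have h1 : 2 * b ≤ X ^ (p - 1) := by
      have := Real.rpow_le_rpow hR0.le hlt.le hp1.le
      rwa [hR, one_div, Real.rpow_inv_rpow (by linarith) hp1.ne'] at this
    have h2 : X ^ p = X ^ (p - 1) * X := by
      rw [← Real.rpow_add_one hX0.ne', sub_add_cancel]
    have h3 := mul_le_mul_of_nonneg_right h1 hX0.le
    have h4 : b * R < b * X := by gcongr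
    nlinarith
  linarith

/-- One step of the level set iteration: if `{u > r}` has weight at most `m` and the data are small,
measured by `b`, on sets of weight at most `2 m`, then `{u > r + d}` has weight at most `2 η`. The
level gap `d` is split in three, so as to pass from `u` to an approximating function and back by
convergence in measure. -/
theorem IsWeakSubsolution.measure_superlevel_add_le {n : ℕ} {Ω : Set (EuclideanSpace ℝ (Fin n))}
    (hΩ : IsOpen Ω) {v : EuclideanSpace ℝ (Fin n) → ℝ} {p σ : ℝ} (hp : 1 < p) (hσ : 1 < σ)
    {t : EuclideanSpace ℝ (Fin n) → EuclideanSpace ℝ (Fin n)}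
    (ht : AEMeasurable t (volume.restrict Ω)) {S K : ℝ≥0}
    {Q : EuclideanSpace ℝ (Fin n) → Matrix (Fin n) (Fin n) ℝ}
    (hQ : ∀ i j, AEMeasurable (fun x => Q x i j) (volume.restrict Ω))
    (hpos : ∀ x ∈ Ω, (Q x).PosSemidef)
    (hSob : SobolevInequality Ω v Q p (powerFun (σ * p)) S) (hSub : IsSubunit Ω v Q p t K)
    {f g u : EuclideanSpace ℝ (Fin n) → ℝ} {G : EuclideanSpace ℝ (Fin n) → EuclideanSpace ℝ (Fin n)}
    (hf : AEMeasurable f (weightMeasure v Ω)) (hg : AEMeasurable g (weightMeasure v Ω))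
    (hu : IsWeakSubsolution Ω v Q p t f g u G)
    {r m b d η : ℝ} (hr : 0 ≤ r) (hm : 0 < m) (hb : 0 < b) (hd : 0 < d) (hη : 0 < η)
    (hmr : weightMeasure v Ω {x | r < u x} ≤ ENNReal.ofReal m)
    (hdata : ∀ E : Set (EuclideanSpace ℝ (Fin n)), MeasurableSet E →
      weightMeasure v Ω E ≤ ENNReal.ofReal (2 * m) →
      (S * eLpNorm (fun x => |f x| ^ (p - 1)) (ENNReal.ofReal σ.conjExponent)
          ((weightMeasure v Ω).restrict E)
        + K * eLpNorm (fun x => |g x| ^ (p - 1))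
          (ENNReal.ofReal (p.conjExponent * σ.conjExponent)) ((weightMeasure v Ω).restrict E))
        * weightMeasure v Ω E ^ ((p - 1) / (σ * p)) ≤ ENNReal.ofReal b)
    (hgap : S * (2 * (2 * b) ^ (1 / (p - 1))) ≤ d / 3 * η ^ (1 / (σ * p))) :
    weightMeasure v Ω {x | r + d < u x} ≤ ENNReal.ofReal (2 * η) := by
  obtain ⟨huL, -, -, ψ, hψ, hψu, hψG⟩ := hu.1
  have hp0 : 0 < p := by linarith
  have hσp : 0 < σ * p := by nlinarith
  set ν := weightMeasure v Ω with hν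
  have hψm : ∀ j, Measurable (ψ j) := fun j => ((hψ j).continuous hΩ).measurable
  have hmeas := tendstoInMeasure_iff_norm.1 (tendstoInMeasure_of_tendsto_eLpNorm
    (f := ψ) (g := u) (l := atTop) (by simpa using hp0 : ENNReal.ofReal p ≠ 0)
    (fun j => (hψm j).aestronglyMeasurable) huL.1 hψu) (d / 3) (by positivity)
  obtain ⟨δ, hδ, habs⟩ := exists_pos_add_le_of_rpow_sub_le (p := p) (b := b)
    (Y := (matrixNorm Q p Ω G).toReal) hp hb ENNReal.toReal_nonneg
  obtain ⟨j, ⟨hj1, hj2⟩, hj3⟩ :=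
    (((hmeas.eventually_lt_const (ENNReal.ofReal_pos.2 hm)).and
      (hmeas.eventually_lt_const (ENNReal.ofReal_pos.2 hη))).and
      (hψG.eventually_lt_const (ENNReal.ofReal_pos.2 hδ))).exists
  have hE : MeasurableSet {x | r + d / 3 < ψ j x} := measurableSet_lt measurable_const (hψm j)
  have hEm : ν {x | r + d / 3 < ψ j x} ≤ ENNReal.ofReal (2 * m) := by
    have hsub : {x | r + d / 3 < ψ j x} ⊆ {x | r < u x} ∪ {x | d / 3 ≤ ‖ψ j x - u x‖} := by
      intro x hx
      simp only [mem_union, mem_ofPred_eq] at hx ⊢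
      by_cases hxu : r < u x
      · exact Or.inl hxu
      · exact Or.inr ((by linarith : d / 3 ≤ ψ j x - u x).trans (le_abs_self _))
    calc _ ≤ ν {x | r < u x} + ν {x | d / 3 ≤ ‖ψ j x - u x‖} :=
          (measure_mono hsub).trans (measure_union_le _ _)
      _ ≤ ENNReal.ofReal m + ENNReal.ofReal m := add_le_add hmr hj1.le
      _ = _ := by rw [← ENNReal.ofReal_add hm.le hm.le, two_mul]
  obtain ⟨hen, hsob⟩ := hu.truncation_energy hΩ hp hσ ht hQ hpos hSob hSub hf hg (hψ j)
    (hj3.trans ENNReal.ofReal_lt_top) (r := r + d / 3) (by positivity) hb.le (hdata _ hE hEm)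
  have hXW := habs _ _ ENNReal.toReal_nonneg
    (ENNReal.toReal_le_of_le_ofReal hδ.le hj3.le) hen
  have hlev : ν {x | r + 2 * d / 3 < ψ j x} ≤ ENNReal.ofReal η := by
    have h1 := ofReal_sub_mul_measure_rpow_le (ν := ν) (a := σ * p) (r := r + d / 3)
      (s := r + 2 * d / 3) hσp (hψm j).aemeasurable
    have h2 : ENNReal.ofReal (d / 3) * ν {x | r + 2 * d / 3 < ψ j x} ^ (1 / (σ * p)) ≤
        ENNReal.ofReal (d / 3) * ENNReal.ofReal η ^ (1 / (σ * p)) := by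
      rw [show r + 2 * d / 3 - (r + d / 3) = d / 3 by ring] at h1
      refine h1.trans (hsob.trans ?_)
      rw [ENNReal.ofReal_rpow_of_pos hη, ← ENNReal.ofReal_mul (by positivity),
        ← ENNReal.ofReal_coe_nnreal (p := S), ← ENNReal.ofReal_mul S.coe_nonneg]
      exact ENNReal.ofReal_le_ofReal ((mul_le_mul_of_nonneg_left hXW S.coe_nonneg).trans hgap)
    have h3 := (ENNReal.mul_le_mul_iff_right (by simpa using hd) ENNReal.ofReal_ne_top).1 h2
    exact (ENNReal.rpow_le_rpow_iff (by positivity)).1 h3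
  have hsub : {x | r + d < u x} ⊆
      {x | r + 2 * d / 3 < ψ j x} ∪ {x | d / 3 ≤ ‖ψ j x - u x‖} := by
    intro x hx
    simp only [mem_union, mem_ofPred_eq] at hx ⊢
    by_cases hxu : r + 2 * d / 3 < ψ j x
    · exact Or.inl hxu
    · refine Or.inr ?_
      rw [norm_sub_rev]
      exact (by linarith : d / 3 ≤ u x - ψ j x).trans (le_abs_self _)
  calc _ ≤ ν {x | r + 2 * d / 3 < ψ j x} + ν {x | d / 3 ≤ ‖ψ j x - u x‖} :=
        (measure_mono hsub).trans (measure_union_le _ _)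
    _ ≤ ENNReal.ofReal η + ENNReal.ofReal η := add_le_add hlev hj2.le
    _ = _ := by rw [← ENNReal.ofReal_add hη.le hη.le, two_mul]

/-! ### Decay of Orlicz functions on small sets -/

theorem one_le_log_exp_one_add {s : ℝ} (hs : 0 ≤ s) : 1 ≤ Real.log (Real.exp 1 + s) := by
  rw [Real.le_log_iff_exp_le (by positivity)]
  linarith

theorem logBump_monotoneOn {α q : ℝ} (hα : 0 ≤ α) (hq : 0 ≤ q) :
    MonotoneOn (logBump α q) (Ici 0) := by
  intro s hs t ht hst
  have hs0 : 0 ≤ s := hs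
  have h1 := one_le_log_exp_one_add hs0
  have h2 : 0 ≤ t ^ α := Real.rpow_nonneg ht _
  unfold logBump
  gcongr

theorem lintegral_le_one_of_luxemburgNorm_lt {X : Type*} [MeasurableSpace X] {ν : Measure X}
    {A : ℝ → ℝ} (hA : MonotoneOn A (Ici 0)) {h : X → ℝ} {D : ℝ}
    (hD : luxemburgNorm A ν h < ENNReal.ofReal D) :
    ∫⁻ x, ENNReal.ofReal (A (|h x| / D)) ∂ν ≤ 1 := by
  simp only [luxemburgNorm, iInf_lt_iff] at hD
  obtain ⟨lam, hlam, hle, hlt⟩ := hD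
  have hlD : lam < D := ((ENNReal.ofReal_lt_ofReal_iff_of_nonneg hlam.le).1 hlt)
  refine (lintegral_mono fun x => ENNReal.ofReal_le_ofReal ?_).trans hle
  refine hA (show 0 ≤ |h x| / D from div_nonneg (abs_nonneg _) (hlam.trans hlD).le)
    (show 0 ≤ |h x| / lam from by positivity) ?_
  gcongr

/-- If the modular of `h` for `t ^ α * log (e + t) ^ q` is at most one, then the integral of
`|h| ^ α` over a set of measure `O(e ^ (-k))` is `O((k + 1) ^ (-q))`. Where `|h| ≤ T` the integrand
is at most `T ^ α`, and elsewhere the logarithm is at least `log (e + T)`; the choice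
`T = e ^ (k / (2 α))` balances the two parts. -/
theorem exists_setLIntegral_rpow_le {X : Type*} [MeasurableSpace X] (ν : Measure X) {α q M : ℝ}
    (hα : 0 < α) (hq : 0 < q) (hM : 0 ≤ M) :
    ∃ c : ℝ, 0 < c ∧ ∀ (h : X → ℝ) (E : Set X) (k : ℕ),
      ∫⁻ x, ENNReal.ofReal (logBump α q |h x|) ∂ν ≤ 1 →
      ν E ≤ ENNReal.ofReal (M * Real.exp (-k)) →
      ∫⁻ x in E, ENNReal.ofReal (|h x| ^ α) ∂ν ≤ ENNReal.ofReal (c * ((k : ℝ) + 1) ^ (-q)) := by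
  refine ⟨M * ((2 * q) ^ q * Real.exp (1 / 2)) + (1 + 2 * α) ^ q, by positivity,
    fun h E k hmod hE => ?_⟩
  set T := Real.exp (k / (2 * α)) with hT
  set ell := Real.log (Real.exp 1 + T) with hell
  have hT0 : 0 < T := Real.exp_pos _
  have hell1 : 1 ≤ ell := one_le_log_exp_one_add hT0.le
  have hk : (0 : ℝ) < (k : ℝ) + 1 := by positivity
  have hTα : T ^ α = Real.exp (k / 2) := by
    rw [hT, ← Real.exp_mul]; congr 1; field_simp
  have hpt : ∀ x, ENNReal.ofReal (|h x| ^ α) ≤ ENNReal.ofReal (Real.exp (k / 2)) +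
      ENNReal.ofReal (logBump α q |h x|) * ENNReal.ofReal (ell ^ (-q)) := fun x => by
    have hb0 : 0 ≤ logBump α q |h x| :=
      mul_nonneg (by positivity)
        (Real.rpow_nonneg (zero_le_one.trans (one_le_log_exp_one_add (abs_nonneg _))) _)
    rw [← ENNReal.ofReal_mul hb0, ← ENNReal.ofReal_add (Real.exp_pos _).le (by positivity)]
    refine ENNReal.ofReal_le_ofReal ?_
    rcases le_total |h x| T with hx | hx
    · have : |h x| ^ α ≤ T ^ α := Real.rpow_le_rpow (abs_nonneg _) hx hα.le
      rw [hTα] at this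
      exact le_add_of_le_of_nonneg this (by positivity)
    · have hl : ell ≤ Real.log (Real.exp 1 + |h x|) := Real.log_le_log (by positivity) (by linarith)
      have h1 : 1 ≤ Real.log (Real.exp 1 + |h x|) ^ q * ell ^ (-q) := by
        have : ell ^ q * ell ^ (-q) = 1 := by
          rw [← Real.rpow_add (by linarith), add_neg_cancel, Real.rpow_zero]
        exact this.symm.le.trans (by gcongr)
      have h2 := mul_le_mul_of_nonneg_left h1 (by positivity : 0 ≤ |h x| ^ α)
      unfold logBump
      have := Real.exp_pos ((k : ℝ) / 2)
      linarith
  have hlog : ell ^ (-q) ≤ (1 + 2 * α) ^ q * ((k : ℝ) + 1) ^ (-q) := by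
    have h1 : (k : ℝ) / (2 * α) ≤ ell := by
      rw [hell, Real.le_log_iff_exp_le (by positivity)]
      have := Real.exp_pos 1
      linarith
    have h2 : (k : ℝ) + 1 ≤ (1 + 2 * α) * ell := by
      rw [div_le_iff₀ (by positivity)] at h1
      linarith
    have h3 := Real.rpow_le_rpow hk.le h2 hq.le
    rw [Real.mul_rpow (by positivity) (by linarith)] at h3
    rw [Real.rpow_neg (by linarith), Real.rpow_neg hk.le, ← div_eq_mul_inv,
      inv_eq_one_div, div_le_div_iff₀ (by positivity) (by positivity)]
    linarith
  have hexp : Real.exp (k / 2) * (M * Real.exp (-k)) ≤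
      M * ((2 * q) ^ q * Real.exp (1 / 2)) * ((k : ℝ) + 1) ^ (-q) := by
    -- `(k + 1) ^ q = O(e ^ (k / 2))`, from `y ≤ e ^ y` at `y = (k + 1) / (2 q)`
    have h1 : (k : ℝ) + 1 ≤ 2 * q * Real.exp ((k + 1) / (2 * q)) := by
      have := Real.add_one_le_exp (((k : ℝ) + 1) / (2 * q))
      have h' : ((k : ℝ) + 1) / (2 * q) ≤ Real.exp ((k + 1) / (2 * q)) := by linarith
      rwa [div_le_iff₀' (by positivity)] at h'
    have h2 := Real.rpow_le_rpow hk.le h1 hq.le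
    rw [Real.mul_rpow (by positivity) (by positivity), ← Real.exp_mul,
      show ((k : ℝ) + 1) / (2 * q) * q = 1 / 2 + k / 2 by field_simp; ring, Real.exp_add] at h2
    have h3 : Real.exp (k / 2) * (M * Real.exp (-k)) = M * (Real.exp (k / 2))⁻¹ := by
      rw [← Real.exp_neg, mul_left_comm, ← Real.exp_add]; congr 2; ring
    rw [h3, mul_assoc]
    refine mul_le_mul_of_nonneg_left ?_ hM
    rw [Real.rpow_neg hk.le, ← div_eq_mul_inv, inv_eq_one_div,
      div_le_div_iff₀ (by positivity) (by positivity)]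
    linarith
  calc _ ≤ ∫⁻ x in E, (ENNReal.ofReal (Real.exp (k / 2)) +
          ENNReal.ofReal (logBump α q |h x|) * ENNReal.ofReal (ell ^ (-q))) ∂ν :=
        lintegral_mono hpt
    _ = ENNReal.ofReal (Real.exp (k / 2)) * ν E +
          (∫⁻ x in E, ENNReal.ofReal (logBump α q |h x|) ∂ν) * ENNReal.ofReal (ell ^ (-q)) := by
        rw [lintegral_add_left measurable_const, setLIntegral_const,
          lintegral_mul_const' _ _ ENNReal.ofReal_ne_top]
    _ ≤ ENNReal.ofReal (Real.exp (k / 2)) * ENNReal.ofReal (M * Real.exp (-k)) +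
          1 * ENNReal.ofReal (ell ^ (-q)) := by
        gcongr
        exact (setLIntegral_le_lintegral _ _).trans hmod
    _ = ENNReal.ofReal (Real.exp (k / 2) * (M * Real.exp (-k)) + ell ^ (-q)) := by
        rw [one_mul, ← ENNReal.ofReal_mul (by positivity),
          ← ENNReal.ofReal_add (by positivity) (by positivity)]
    _ ≤ _ := by
        refine ENNReal.ofReal_le_ofReal ?_
        rw [add_mul]
        exact add_le_add hexp hlog

theorem exists_eLpNorm_restrict_rpow_le {X : Type*} [MeasurableSpace X] (ν : Measure X)
    {β γ q M : ℝ} (hβ : 0 < β) (hγ : 0 < γ) (hq : 0 < q) (hM : 0 ≤ M) :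
    ∃ c : ℝ, 0 < c ∧ ∀ (h : X → ℝ) (D : ℝ) (E : Set X) (k : ℕ), 0 < D →
      luxemburgNorm (logBump (β * γ) q) ν h < ENNReal.ofReal D →
      ν E ≤ ENNReal.ofReal (M * Real.exp (-k)) →
      eLpNorm (fun x => |h x| ^ β) (ENNReal.ofReal γ) (ν.restrict E) ≤
        ENNReal.ofReal (c * (D ^ β * ((k : ℝ) + 1) ^ (-(q / γ)))) := by
  obtain ⟨c, hc, H⟩ := exists_setLIntegral_rpow_le ν (mul_pos hβ hγ) hq hM
  refine ⟨c ^ (1 / γ), by positivity, fun h D E k hD hlux hE => ?_⟩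
  have hmod := lintegral_le_one_of_luxemburgNorm_lt
    (logBump_monotoneOn (mul_pos hβ hγ).le hq.le) hlux
  have hk : (0 : ℝ) < (k : ℝ) + 1 := by positivity
  have h1 := H (fun x => h x / D) E k (by simpa only [abs_div, abs_of_pos hD] using hmod) hE
  rw [eLpNorm_eq_lintegral_rpow_enorm_toReal (by simpa using hγ) ENNReal.ofReal_ne_top,
    ENNReal.toReal_ofReal hγ.le]
  have hpt : ∀ x, ‖|h x| ^ β‖ₑ ^ γ =
      ENNReal.ofReal (D ^ (β * γ)) * ENNReal.ofReal (|h x / D| ^ (β * γ)) := fun x => by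
    rw [Real.enorm_eq_ofReal (by positivity), ENNReal.ofReal_rpow_of_nonneg (by positivity) hγ.le,
      ← Real.rpow_mul (abs_nonneg _), ← ENNReal.ofReal_mul (by positivity),
      ← Real.mul_rpow hD.le (abs_nonneg _), abs_div, abs_of_pos hD, mul_div_cancel₀ _ hD.ne']
  simp_rw [hpt]
  rw [lintegral_const_mul' _ _ ENNReal.ofReal_ne_top]
  calc _ ≤ (ENNReal.ofReal (D ^ (β * γ)) *
        ENNReal.ofReal (c * ((k : ℝ) + 1) ^ (-q))) ^ (1 / γ) := by gcongr
    _ = _ := by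
      rw [← ENNReal.ofReal_mul (by positivity),
        ENNReal.ofReal_rpow_of_nonneg (by positivity) (by positivity),
        Real.mul_rpow (by positivity) (by positivity), Real.mul_rpow hc.le (by positivity),
        ← Real.rpow_mul hD.le, ← Real.rpow_mul hk.le, show β * γ * (1 / γ) = β by field_simp,
        show -q * (1 / γ) = -(q / γ) by ring, mul_left_comm]

/-! ### Iteration over levels -/

theorem isFiniteMeasure_weightMeasure {n : ℕ} {v : EuclideanSpace ℝ (Fin n) → ℝ}
    {Ω : Set (EuclideanSpace ℝ (Fin n))} (hv : IntegrableOn v Ω) :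
    IsFiniteMeasure (weightMeasure v Ω) :=
  isFiniteMeasure_withDensity_ofReal hv.2

/-- A subsolution is bounded above by a constant times any upper bound for the norms of the data.
The levels `r_k = c D ∑_{i < k} (i + 1) ^ (-θ)` satisfy `v({u > r_k}) = O(e ^ (-k))`, and they
converge because `θ = q / (σ' (p - 1)) > 1`. -/
theorem exists_forall_isWeakSubsolution_le {n : ℕ} {Ω : Set (EuclideanSpace ℝ (Fin n))}
    (hΩ : IsOpen Ω) {v : EuclideanSpace ℝ (Fin n) → ℝ} (hv : IntegrableOn v Ω)
    {p σ q : ℝ} (hp : 1 < p) (hσ : 1 < σ) (hq : σ.conjExponent * (p - 1) < q)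
    {t : EuclideanSpace ℝ (Fin n) → EuclideanSpace ℝ (Fin n)}
    (ht : AEMeasurable t (volume.restrict Ω)) (S K : ℝ≥0) :
    ∃ C : ℝ, 0 < C ∧ ∀ Q : EuclideanSpace ℝ (Fin n) → Matrix (Fin n) (Fin n) ℝ,
      (∀ i j, AEMeasurable (fun x => Q x i j) (volume.restrict Ω)) →
      (∀ x ∈ Ω, (Q x).PosSemidef) →
      SobolevInequality Ω v Q p (powerFun (σ * p)) S → IsSubunit Ω v Q p t K →
      ∀ f g u : EuclideanSpace ℝ (Fin n) → ℝ,
      ∀ G : EuclideanSpace ℝ (Fin n) → EuclideanSpace ℝ (Fin n),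
      AEMeasurable f (weightMeasure v Ω) → AEMeasurable g (weightMeasure v Ω) →
      IsWeakSubsolution Ω v Q p t f g u G → ∀ D : ℝ, 0 < D →
      luxemburgNorm (logBump (σ.conjExponent * (p - 1)) q) (weightMeasure v Ω) f
        < ENNReal.ofReal D →
      luxemburgNorm (logBump (p * σ.conjExponent) (q * p.conjExponent)) (weightMeasure v Ω) g
        < ENNReal.ofReal D →
      ∀ᵐ x ∂(weightMeasure v Ω), u x ≤ C * D := by
  set ν := weightMeasure v Ω with hν
  have hfinν : IsFiniteMeasure ν := isFiniteMeasure_weightMeasure hv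
  have hp0 : 0 < p := by linarith
  have hp1 : 0 < p - 1 := by linarith
  have hσ' := (Real.HolderConjugate.conjExponent hσ).symm.pos
  have hp' := (Real.HolderConjugate.conjExponent hp).symm.pos
  have hq0 : 0 < q := (mul_pos hσ' hp1).trans hq
  have hσp : 0 < σ * p := by nlinarith
  -- the summand `1` keeps `M` positive when `ν = 0`
  set M := (ν univ).toReal + 1 with hM
  have hM0 : 0 < M := by positivity
  set θ := q / (σ.conjExponent * (p - 1)) with hθ
  have hθ1 : 1 < θ := (one_lt_div (mul_pos hσ' hp1)).2 hq
  obtain ⟨c1, hc1, H1⟩ := exists_eLpNorm_restrict_rpow_le ν (β := p - 1) (γ := σ.conjExponent)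
    (q := q) (M := 2 * M) hp1 hσ' hq0 (by positivity)
  obtain ⟨c2, hc2, H2⟩ := exists_eLpNorm_restrict_rpow_le ν (β := p - 1)
    (γ := p.conjExponent * σ.conjExponent) (q := q * p.conjExponent) (M := 2 * M) hp1
    (mul_pos hp' hσ') (mul_pos hq0 hp') (by positivity)
  rw [mul_comm] at H1
  rw [show (p - 1) * (p.conjExponent * σ.conjExponent) = p * σ.conjExponent by
      rw [Real.conjExponent, Real.conjExponent]; field_simp,
    show q * p.conjExponent / (p.conjExponent * σ.conjExponent) = q / σ.conjExponent by
      field_simp] at H2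
  -- the summand `1` keeps `c3` positive when `S = K = 0`; likewise for `S + 1` in `c`
  set c3 : ℝ := S * c1 + K * c2 + 1 with hc3
  have hc30 : 0 < c3 := by positivity
  -- three parts of the level gap and the factor `2` of `exists_pos_add_le_of_rpow_sub_le` give `6`;
  -- `4 e` is the ratio of `2 m` to `m / (2 e)`, the bounds before and after a step
  set c : ℝ := 6 * (S + 1) * (2 * c3) ^ (1 / (p - 1)) * (4 * Real.exp 1) ^ (1 / (σ * p)) with hc
  have hc0 : 0 < c := by positivity
  have hsum : Summable fun i : ℕ => ((i : ℝ) + 1) ^ (-θ) := by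
    have := (summable_nat_add_iff 1).2 (Real.summable_nat_rpow.2 (neg_lt_neg hθ1))
    simpa using this
  set Z := ∑' i : ℕ, ((i : ℝ) + 1) ^ (-θ) with hZ
  have hterm : ∀ i : ℕ, 0 < ((i : ℝ) + 1) ^ (-θ) := fun i => by positivity
  refine ⟨c * Z, mul_pos hc0 (hsum.tsum_pos (fun i => (hterm i).le) 0 (hterm 0)),
    fun Q hQ hpos hSob hSub f g u G hf hg hu D hD hfD hgD => ?_⟩
  have hlev : ∀ k : ℕ, ν {x | c * D * ∑ i ∈ Finset.range k, ((i : ℝ) + 1) ^ (-θ) < u x} ≤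
      ENNReal.ofReal (M * Real.exp (-k)) := by
    intro k
    induction k with
    | zero =>
      simp only [Nat.cast_zero, neg_zero, Real.exp_zero, mul_one]
      refine (measure_mono (subset_univ _)).trans ?_
      rw [← ENNReal.ofReal_toReal (measure_ne_top ν univ)]
      exact ENNReal.ofReal_le_ofReal (by linarith)
    | succ k ih =>
      have hk : (0 : ℝ) < (k : ℝ) + 1 := by positivity
      set m := M * Real.exp (-k) with hm
      have hm0 : 0 < m := by positivity
      set b := c3 * D ^ (p - 1) * ((k : ℝ) + 1) ^ (-(q / σ.conjExponent)) *
        (2 * m) ^ ((p - 1) / (σ * p)) with hb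
      have hb0 : 0 < b := by positivity
      rw [Finset.sum_range_succ, mul_add]
      have hη : M * Real.exp (-((k + 1 : ℕ) : ℝ)) = 2 * (m / (2 * Real.exp 1)) := by
        rw [hm]
        push_cast
        rw [neg_add, Real.exp_add, Real.exp_neg 1]
        field_simp
      rw [hη]
      refine hu.measure_superlevel_add_le hΩ hp hσ ht hQ hpos hSob hSub hf hg (m := m) (b := b)
        (mul_nonneg (by positivity) (Finset.sum_nonneg fun i _ => (hterm i).le)) hm0 hb0
        (by positivity) (by positivity) ih (fun E _ hE => ?_) ?_
      · have hE' : ν E ≤ ENNReal.ofReal (2 * M * Real.exp (-k)) := by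
          rwa [mul_assoc]
        calc _ ≤ (S * ENNReal.ofReal (c1 * (D ^ (p - 1) *
                ((k : ℝ) + 1) ^ (-(q / σ.conjExponent)))) +
              K * ENNReal.ofReal (c2 * (D ^ (p - 1) *
                ((k : ℝ) + 1) ^ (-(q / σ.conjExponent))))) *
              ENNReal.ofReal (2 * m) ^ ((p - 1) / (σ * p)) := by
              gcongr
              · exact H1 f D E k hD hfD hE'
              · exact H2 g D E k hD hgD hE'
          _ = ENNReal.ofReal ((S * (c1 * (D ^ (p - 1) *
                ((k : ℝ) + 1) ^ (-(q / σ.conjExponent)))) +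
              K * (c2 * (D ^ (p - 1) *
                ((k : ℝ) + 1) ^ (-(q / σ.conjExponent))))) *
              (2 * m) ^ ((p - 1) / (σ * p))) := by
              symm
              rw [ENNReal.ofReal_mul (by positivity), ENNReal.ofReal_add (by positivity)
                (by positivity), ENNReal.ofReal_mul S.coe_nonneg, ENNReal.ofReal_mul K.coe_nonneg,
                ENNReal.ofReal_coe_nnreal, ENNReal.ofReal_coe_nnreal,
                ENNReal.ofReal_rpow_of_pos (by positivity)]
          _ ≤ ENNReal.ofReal b := by
              refine ENNReal.ofReal_le_ofReal ?_
              rw [hb]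
              refine mul_le_mul_of_nonneg_right ?_ (by positivity)
              have : 0 < D ^ (p - 1) * ((k : ℝ) + 1) ^ (-(q / σ.conjExponent)) := by positivity
              rw [hc3]
              linarith
      · have hbpow : (2 * b) ^ (1 / (p - 1)) = (2 * c3) ^ (1 / (p - 1)) * D *
            ((k : ℝ) + 1) ^ (-θ) * (2 * m) ^ (1 / (σ * p)) := by
          rw [hb, show 2 * (c3 * D ^ (p - 1) * ((k : ℝ) + 1) ^ (-(q / σ.conjExponent)) *
              (2 * m) ^ ((p - 1) / (σ * p))) = 2 * c3 * D ^ (p - 1) *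
              ((k : ℝ) + 1) ^ (-(q / σ.conjExponent)) * (2 * m) ^ ((p - 1) / (σ * p)) by ring,
            Real.mul_rpow (by positivity) (by positivity),
            Real.mul_rpow (by positivity) (by positivity),
            Real.mul_rpow (by positivity) (by positivity), ← Real.rpow_mul hD.le,
            ← Real.rpow_mul hk.le, ← Real.rpow_mul (by positivity : 0 ≤ 2 * m),
            mul_one_div_cancel hp1.ne', Real.rpow_one, hθ,
            show -(q / σ.conjExponent) * (1 / (p - 1)) = -(q / (σ.conjExponent * (p - 1))) by
              field_simp,
            show (p - 1) / (σ * p) * (1 / (p - 1)) = 1 / (σ * p) by field_simp]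
        have h2m : (2 * m) ^ (1 / (σ * p)) =
            (4 * Real.exp 1) ^ (1 / (σ * p)) * (m / (2 * Real.exp 1)) ^ (1 / (σ * p)) := by
          rw [← Real.mul_rpow (by positivity) (by positivity)]
          congr 1
          field_simp
          norm_num
        rw [hbpow, h2m, hc]
        have hP : 0 ≤ (2 * c3) ^ (1 / (p - 1)) * D * ((k : ℝ) + 1) ^ (-θ) *
          ((4 * Real.exp 1) ^ (1 / (σ * p)) * (m / (2 * Real.exp 1)) ^ (1 / (σ * p))) := by
          positivity
        linarith
  have hzero : ν {x | c * Z * D < u x} = 0 := by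
    have hle : ∀ k : ℕ, ν {x | c * Z * D < u x} ≤ ENNReal.ofReal (M * Real.exp (-k)) := fun k => by
      refine (measure_mono fun x hx => ?_).trans (hlev k)
      simp only [mem_ofPred_eq] at hx ⊢
      refine lt_of_le_of_lt ?_ hx
      have := hsum.sum_le_tsum (Finset.range k) fun i _ => (hterm i).le
      calc _ ≤ c * D * Z := by gcongr
        _ = _ := by ring
    have hlim : Tendsto (fun k : ℕ => ENNReal.ofReal (M * Real.exp (-k))) atTop (𝓝 0) := by
      have := (Real.tendsto_exp_neg_atTop_nhds_zero.comp
        (tendsto_natCast_atTop_atTop (R := ℝ))).const_mul M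
      rw [mul_zero] at this
      simpa using ENNReal.tendsto_ofReal this
    exact le_antisymm (ge_of_tendsto' hlim hle) zero_le
  rw [ae_iff]
  simpa only [not_le] using hzero

/-! ### Boundedness -/

theorem luxemburgNorm_neg {X : Type*} [MeasurableSpace X] (A : ℝ → ℝ) (ν : Measure X)
    (h : X → ℝ) : luxemburgNorm A ν (fun x => -h x) = luxemburgNorm A ν h := by
  simp only [luxemburgNorm, abs_neg]

theorem MemOrlicz.neg {X : Type*} [MeasurableSpace X] {A : ℝ → ℝ} {ν : Measure X} {h : X → ℝ}
    (hh : MemOrlicz A ν h) : MemOrlicz A ν (fun x => -h x) :=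
  ⟨hh.1.neg, by rw [luxemburgNorm_neg]; exact hh.2⟩

theorem matrixNorm_neg {n : ℕ} (Q : EuclideanSpace ℝ (Fin n) → Matrix (Fin n) (Fin n) ℝ) (p : ℝ)
    (Ω : Set (EuclideanSpace ℝ (Fin n)))
    (G : EuclideanSpace ℝ (Fin n) → EuclideanSpace ℝ (Fin n)) :
    matrixNorm Q p Ω (fun x => -G x) = matrixNorm Q p Ω G := by
  simp only [matrixNorm, sqrtMulNorm_neg]

theorem MemQH0.neg {n : ℕ} {Ω : Set (EuclideanSpace ℝ (Fin n))}
    {v : EuclideanSpace ℝ (Fin n) → ℝ}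
    {Q : EuclideanSpace ℝ (Fin n) → Matrix (Fin n) (Fin n) ℝ} {p : ℝ}
    {u : EuclideanSpace ℝ (Fin n) → ℝ} {G : EuclideanSpace ℝ (Fin n) → EuclideanSpace ℝ (Fin n)}
    (hu : MemQH0 Ω v Q p u G) : MemQH0 Ω v Q p (fun x => -u x) (fun x => -G x) := by
  obtain ⟨h1, h2, h3, ψ, hψ, h4, h5⟩ := hu
  refine ⟨h1.neg, h2.neg, by rwa [matrixNorm_neg], fun j x => -ψ j x, fun j => (hψ j).neg, ?_, ?_⟩
  · refine h4.congr fun j => ?_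
    rw [← eLpNorm_neg]
    congr 1
    funext x
    simp only [Pi.neg_apply]
    ring
  · refine h5.congr fun j => ?_
    rw [← matrixNorm_neg]
    congr 1
    funext x
    rw [gradient_neg', neg_sub, sub_neg_eq_add, sub_eq_neg_add]

theorem IsWeakSupersolution.neg {n : ℕ} {Ω : Set (EuclideanSpace ℝ (Fin n))}
    {v : EuclideanSpace ℝ (Fin n) → ℝ}
    {Q : EuclideanSpace ℝ (Fin n) → Matrix (Fin n) (Fin n) ℝ} {p : ℝ}
    {t : EuclideanSpace ℝ (Fin n) → EuclideanSpace ℝ (Fin n)}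
    {f g u : EuclideanSpace ℝ (Fin n) → ℝ} {G : EuclideanSpace ℝ (Fin n) → EuclideanSpace ℝ (Fin n)}
    (hu : IsWeakSupersolution Ω v Q p t f g u G) :
    IsWeakSubsolution Ω v Q p t (fun x => -f x) (fun x => -g x) (fun x => -u x)
      (fun x => -G x) := by
  refine ⟨hu.1.neg, fun φ hφ hφ0 => ?_⟩
  have hL : weakLHS Ω Q p (fun x => -G x) φ = -weakLHS Ω Q p G φ := by
    simp only [weakLHS, sqrtMulNorm_neg, map_neg, inner_neg_right, mul_neg, integral_neg]
  have hR : weakRHS Ω v p t (fun x => -f x) (fun x => -g x) φ = -weakRHS Ω v p t f g φ := by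
    simp only [weakRHS, abs_neg]
    rw [← integral_neg]
    congr 1
    funext x
    ring
  rw [hL, hR]
  exact neg_le_neg (hu.2 φ hφ hφ0)

/-- Passage from bounds `u ≤ C D`, for all `D > N`, to a bound on `u⁺`. -/
theorem eLpNorm_top_max_zero_le {X : Type*} [MeasurableSpace X] {ν : Measure X} {u : X → ℝ}
    {C : ℝ≥0} {N : ℝ≥0∞} (hN : N < ∞)
    (h : ∀ D : ℝ, 0 < D → N < ENNReal.ofReal D → ∀ᵐ x ∂ν, u x ≤ C * D) :
    eLpNorm (fun x => max (u x) 0) ∞ ν ≤ C * N := by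
  have hle : ∀ᵐ x ∂ν, u x ≤ C * N.toReal := by
    have hall : ∀ᵐ x ∂ν, ∀ k : ℕ, u x ≤ C * (N.toReal + 1 / ((k : ℝ) + 1)) := by
      refine ae_all_iff.2 fun k => h _ (by positivity) ?_
      rw [← ENNReal.ofReal_toReal hN.ne, ENNReal.ofReal_lt_ofReal_iff (by positivity),
        ENNReal.toReal_ofReal ENNReal.toReal_nonneg]
      have : (0 : ℝ) < 1 / ((k : ℝ) + 1) := by positivity
      linarith
    filter_upwards [hall] with x hx
    have hlim := (tendsto_one_div_add_atTop_nhds_zero_nat (𝕜 := ℝ)).const_add N.toReal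
    rw [add_zero] at hlim
    exact ge_of_tendsto' (hlim.const_mul (C : ℝ)) hx
  rw [eLpNorm_exponent_top]
  calc _ ≤ ENNReal.ofReal (C * N.toReal) := by
        refine eLpNormEssSup_le_of_ae_bound ?_
        filter_upwards [hle] with x hx
        rw [Real.norm_of_nonneg (le_max_right _ _)]
        exact max_le hx (by positivity)
    _ = C * N := by
        rw [ENNReal.ofReal_mul C.coe_nonneg, ENNReal.ofReal_coe_nnreal,
          ENNReal.ofReal_toReal hN.ne]

theorem mainTheorem1 (n : ℕ) (Ω : Set (EuclideanSpace ℝ (Fin n)))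
    (hΩ_open : IsOpen Ω) (hΩ_conn : IsConnected Ω) (hΩ_bdd : Bornology.IsBounded Ω)
    (v : EuclideanSpace ℝ (Fin n) → ℝ) (hv_nonneg : ∀ x ∈ Ω, 0 ≤ v x)
    (hv_int : IntegrableOn v Ω)
    (p σ q : ℝ) (hp : 1 < p) (hσ : 1 < σ) (hq : Real.conjExponent σ * (p - 1) < q)
    (t : EuclideanSpace ℝ (Fin n) → EuclideanSpace ℝ (Fin n))
    (ht : AEMeasurable t (volume.restrict Ω))
    (S K : ℝ≥0) :
    ∃ C : ℝ≥0,
      ∀ (Q : EuclideanSpace ℝ (Fin n) → Matrix (Fin n) (Fin n) ℝ) (k : ℝ),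
        (∀ i j, AEMeasurable (fun x => Q x i j) (volume.restrict Ω)) →
        (∀ x ∈ Ω, (Q x).PosSemidef) →
        (∀ᵐ x ∂(volume.restrict Ω), ‖Matrix.toEuclideanCLM (𝕜 := ℝ) (Q x)‖ ^ (p / 2) ≤ k * v x) →
        SobolevInequality Ω v Q p (powerFun (σ * p)) S →
        IsSubunit Ω v Q p t K →
        ∀ f g : EuclideanSpace ℝ (Fin n) → ℝ,
          MemOrlicz (logBump (Real.conjExponent σ * (p - 1)) q) (weightMeasure v Ω) f →
          MemOrlicz (logBump (p * Real.conjExponent σ) (q * Real.conjExponent p))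
            (weightMeasure v Ω) g →
          ∀ (u : EuclideanSpace ℝ (Fin n) → ℝ)
            (G : EuclideanSpace ℝ (Fin n) → EuclideanSpace ℝ (Fin n)),
            (IsWeakSubsolution Ω v Q p t f g u G →
              MemLp (fun x => max (u x) 0) ∞ (weightMeasure v Ω) ∧
              eLpNorm (fun x => max (u x) 0) ∞ (weightMeasure v Ω) ≤
                C * (luxemburgNorm (logBump (Real.conjExponent σ * (p - 1)) q)
                      (weightMeasure v Ω) f +
                    luxemburgNorm (logBump (p * Real.conjExponent σ) (q * Real.conjExponent p))
                      (weightMeasure v Ω) g)) ∧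
            (IsWeakSupersolution Ω v Q p t f g u G →
              MemLp (fun x => max (-u x) 0) ∞ (weightMeasure v Ω) ∧
              eLpNorm (fun x => max (-u x) 0) ∞ (weightMeasure v Ω) ≤
                C * (luxemburgNorm (logBump (Real.conjExponent σ * (p - 1)) q)
                      (weightMeasure v Ω) f +
                    luxemburgNorm (logBump (p * Real.conjExponent σ) (q * Real.conjExponent p))
                      (weightMeasure v Ω) g)) ∧
            (IsWeakSolution Ω v Q p t f g u G →
              MemLp u ∞ (weightMeasure v Ω) ∧
              eLpNorm u ∞ (weightMeasure v Ω) ≤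
                C * (luxemburgNorm (logBump (Real.conjExponent σ * (p - 1)) q)
                      (weightMeasure v Ω) f +
                    luxemburgNorm (logBump (p * Real.conjExponent σ) (q * Real.conjExponent p))
                      (weightMeasure v Ω) g)) := by
  obtain ⟨C, hC, H⟩ := exists_forall_isWeakSubsolution_le hΩ_open hv_int hp hσ hq ht S K
  refine ⟨C.toNNReal, ?_⟩
  intro Q k hQ hpos _ hSob hSub f g hf hg u G
  set ν := weightMeasure v Ω
  set NF := luxemburgNorm (logBump (σ.conjExponent * (p - 1)) q) ν f with hNF
  set NG := luxemburgNorm (logBump (p * σ.conjExponent) (q * p.conjExponent)) ν g with hNG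
  have hN : NF + NG < ∞ := ENNReal.add_lt_top.2 ⟨hf.2, hg.2⟩
  have hfin : (C.toNNReal : ℝ≥0∞) * (NF + NG) < ∞ := ENNReal.mul_lt_top ENNReal.coe_lt_top hN
  have key : ∀ (f' g' w : EuclideanSpace ℝ (Fin n) → ℝ)
      (G' : EuclideanSpace ℝ (Fin n) → EuclideanSpace ℝ (Fin n)),
      MemOrlicz (logBump (σ.conjExponent * (p - 1)) q) ν f' →
      MemOrlicz (logBump (p * σ.conjExponent) (q * p.conjExponent)) ν g' →
      luxemburgNorm (logBump (σ.conjExponent * (p - 1)) q) ν f' = NF →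
      luxemburgNorm (logBump (p * σ.conjExponent) (q * p.conjExponent)) ν g' = NG →
      IsWeakSubsolution Ω v Q p t f' g' w G' →
      MemLp (fun x => max (w x) 0) ∞ ν ∧
        eLpNorm (fun x => max (w x) 0) ∞ ν ≤ C.toNNReal * (NF + NG) := by
    intro f' g' w G' hf' hg' ef eg hw
    have hb : eLpNorm (fun x => max (w x) 0) ∞ ν ≤ C.toNNReal * (NF + NG) := by
      refine eLpNorm_top_max_zero_le hN fun D hD hlt => ?_
      rw [Real.coe_toNNReal _ hC.le]
      exact H Q hQ hpos hSob hSub f' g' w G' hf'.1 hg'.1 hw D hD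
        (ef ▸ lt_of_le_of_lt le_self_add hlt) (eg ▸ lt_of_le_of_lt le_add_self hlt)
    exact ⟨⟨(hw.1.1.1.aemeasurable.max aemeasurable_const).aestronglyMeasurable,
      hb.trans_lt hfin⟩, hb⟩
  have hsub : IsWeakSubsolution Ω v Q p t f g u G →
      MemLp (fun x => max (u x) 0) ∞ ν ∧
        eLpNorm (fun x => max (u x) 0) ∞ ν ≤ C.toNNReal * (NF + NG) :=
    key f g u G hf hg rfl rfl
  have hsup : IsWeakSupersolution Ω v Q p t f g u G →
      MemLp (fun x => max (-u x) 0) ∞ ν ∧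
        eLpNorm (fun x => max (-u x) 0) ∞ ν ≤ C.toNNReal * (NF + NG) := fun hu =>
    key _ _ _ _ hf.neg hg.neg (luxemburgNorm_neg _ _ _) (luxemburgNorm_neg _ _ _) hu.neg
  refine ⟨hsub, hsup, fun hu => ?_⟩
  have h1 := (hsub ⟨hu.1, fun φ hφ _ => (hu.2 φ hφ).le⟩).2
  have h2 := (hsup ⟨hu.1, fun φ hφ _ => (hu.2 φ hφ).ge⟩).2
  have hb : eLpNorm u ∞ ν ≤ C.toNNReal * (NF + NG) := by
    rw [eLpNorm_exponent_top] at h1 h2 ⊢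
    refine essSup_le_of_ae_le _ ?_
    filter_upwards [ae_le_eLpNormEssSup (f := fun x => max (u x) 0) (μ := ν),
      ae_le_eLpNormEssSup (f := fun x => max (-u x) 0) (μ := ν)] with x hx1 hx2
    rcases le_total 0 (u x) with h0 | h0
    · rw [max_eq_left h0] at hx1
      exact hx1.trans h1
    · rw [max_eq_left (neg_nonneg.2 h0), enorm_neg] at hx2
      exact hx2.trans h2
  exact ⟨⟨hu.1.1.1, hb.trans_lt hfin⟩, hb⟩
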